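/- Let $U=\mathcal U_q(\mathfrak{sl}_2)$ be the $\mathbb C(q)$-algebra generated by $K^{\pm1},E,F$ with relations $KK^{-1}=K^{-1}K=1$, $KE=q^2EK$, $KF=q^{-2}FK$, $EF-FE=\frac{K-K^{-1}}{q-q^{-1}}$, with comultiplication $\Delta(K)=K\otimes K$, $\Delta(E)=E\otimes K+1\otimes E$, $\Delta(F)=F\otimes 1+K^{-1}\otimes F$ and antipode $S(K)=K^{-1}$, $S(E)=-EK^{-1}$, $S(F)=-KF$. Grade $U$ by $|E|=1$, $|F|=-1$, $|K|=0$. Let $h\rhd x=\sum h_{(1)}xS(h_{(2)})$ be the left adjoint action, and let $A=U^{\mathrm{lf}}=\{x\in U: \dim_{\mathbb C(q)}(U\rhd x)<\infty\}$ be the locally finite part. For $i\ge 0$ put $$u_i\otimes v_i=q^{i(i-1)/2}\frac{(q-q^{-1})^i}{[i]!}\,E^i\otimes F^i ,\qquad [i]!=\prod_{j=1}^i\frac{q^j-q^{-j}}{q-q^{-1}} .$$ The braided tensor powers are defined by $A^{\tilde\otimes 1}=A$ and, for $n\ge 2$, $A^{\tilde\otimes n}=A\otimes A^{\tilde\otimes(n-1)}$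 as a vector space, with total grading, with $U$ acting through $\Delta$, with unit $1\otimes 1$, and with the product given on homogeneous elements by $$(g\otimes h)\cdot(x\otimes y)=\sum_{i\ge0}q^{2(|h|+i)(|x|-i)}\,g\,(v_i\rhd x)\otimes(u_i\rhd h)\cdot y .$$ All sums over $i$ here and below have finitely many nonzero terms. Then for every $n\ge1$ the space $A^{\tilde\otimes n}$ with this product is an associative unital algebra, and the following hold. (1) For every $n\ge2$, the linear map $$\varphi_n\colon A^{\tilde\otimes n}\to U\otimes A^{\tilde\otimes(n-1)},\qquad \varphi_n(a\otimes b)=\sum_{i\ge0}aK^{i+|b|}v_i\otimes u_i\rhd b\quad(a\in A,\ b\in A^{\tilde\otimes(n-1)}\text{ homogeneous})$$ is an injective morphism of unital algebras, where the target is the ordinary tensor product of algebras. (2) Let $\gamma_1\colon A\hookrightarrow U$ be the inclusion and $\gamma_{n+1}=(\mathrm{id}\otimes\gamma_n)\circ\varphi_{n+1}$ for $n\ge1$. Then for every $n\ge1$ the map $\gamma_n\colon A^{\tilde\otimes n}\to U^{\otimes n}$ is an injective morphism of unital algebras. -/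

import Mathlib

open scoped TensorProduct

noncomputable section

/-! ### The ground field and the quantum group -/

/-- The ground field `ℂ(q)`. -/
abbrev Cq : Type := RatFunc ℂ

/-- The indeterminate `q` of `ℂ(q)`. -/
def qq : Cq := RatFunc.X

/-- Names of the algebra generators `K`, `K⁻¹`, `E`, `F`. -/
inductive UqGen : Type
  | K | Kinv | E | F

/-- The defining relations of `U_q(sl₂)`. -/
inductive UqRel : FreeAlgebra Cq UqGen → FreeAlgebra Cq UqGen → Prop
  | K_Kinv : UqRel (FreeAlgebra.ι Cq UqGen.K * FreeAlgebra.ι Cq UqGen.Kinv) 1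
  | Kinv_K : UqRel (FreeAlgebra.ι Cq UqGen.Kinv * FreeAlgebra.ι Cq UqGen.K) 1
  | K_E : UqRel (FreeAlgebra.ι Cq UqGen.K * FreeAlgebra.ι Cq UqGen.E)
      (qq ^ 2 • (FreeAlgebra.ι Cq UqGen.E * FreeAlgebra.ι Cq UqGen.K))
  | K_F : UqRel (FreeAlgebra.ι Cq UqGen.K * FreeAlgebra.ι Cq UqGen.F)
      ((qq ^ 2)⁻¹ • (FreeAlgebra.ι Cq UqGen.F * FreeAlgebra.ι Cq UqGen.K))
  | E_F : UqRel (FreeAlgebra.ι Cq UqGen.E * FreeAlgebra.ι Cq UqGen.F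
        - FreeAlgebra.ι Cq UqGen.F * FreeAlgebra.ι Cq UqGen.E)
      ((qq - qq⁻¹)⁻¹ • (FreeAlgebra.ι Cq UqGen.K - FreeAlgebra.ι Cq UqGen.Kinv))

/-- The quantum group `U_q(sl₂)` over `ℂ(q)`. -/
def Uq : Type := RingQuot UqRel

namespace Uq

instance : Ring Uq := inferInstanceAs (Ring (RingQuot UqRel))
instance : Algebra Cq Uq := inferInstanceAs (Algebra Cq (RingQuot UqRel))

/-- The quotient map from the free algebra. -/
def mk : FreeAlgebra Cq UqGen →ₐ[Cq] Uq := RingQuot.mkAlgHom Cq UqRel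

/-- The class of a generator. -/
def gen (g : UqGen) : Uq := mk (FreeAlgebra.ι Cq g)

/-- The generator `K`. -/
def K : Uq := gen UqGen.K
/-- The generator `K⁻¹`. -/
def Kinv : Uq := gen UqGen.Kinv
/-- The generator `E`. -/
def E : Uq := gen UqGen.E
/-- The generator `F`. -/
def F : Uq := gen UqGen.F

theorem K_mul_Kinv : K * Kinv = 1 := by
  have h := RingQuot.mkAlgHom_rel Cq UqRel.K_Kinv
  rw [map_mul, map_one] at h
  exact h

theorem Kinv_mul_K : Kinv * K = 1 := by
  have h := RingQuot.mkAlgHom_rel Cq UqRel.Kinv_K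
  rw [map_mul, map_one] at h
  exact h

theorem K_mul_E : K * E = qq ^ 2 • (E * K) := by
  have h := RingQuot.mkAlgHom_rel Cq UqRel.K_E
  rw [map_smul, map_mul, map_mul] at h
  exact h

theorem K_mul_F : K * F = (qq ^ 2)⁻¹ • (F * K) := by
  have h := RingQuot.mkAlgHom_rel Cq UqRel.K_F
  rw [map_smul, map_mul, map_mul] at h
  exact h

theorem E_F : E * F - F * E = (qq - qq⁻¹)⁻¹ • (K - Kinv) := by
  have h := RingQuot.mkAlgHom_rel Cq UqRel.E_F
  rw [map_smul, map_sub, map_sub, map_mul, map_mul] at h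
  exact h

theorem qq_ne_zero : qq ≠ 0 := RatFunc.X_ne_zero

/-- The universal property: an algebra map out of `U_q(sl₂)` is determined by images `k, l, e, f` of
`K, K⁻¹, E, F` satisfying the defining relations. -/
def lift {B : Type} [Ring B] [Algebra Cq B] (k l e f : B) (h₁ : k * l = 1) (h₂ : l * k = 1)
    (h₃ : k * e = qq ^ 2 • (e * k)) (h₄ : k * f = (qq ^ 2)⁻¹ • (f * k))
    (h₅ : e * f - f * e = (qq - qq⁻¹)⁻¹ • (k - l)) : Uq →ₐ[Cq] B :=
  RingQuot.liftAlgHom Cq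
    ⟨FreeAlgebra.lift Cq (fun g : UqGen => match g with
        | UqGen.K => k | UqGen.Kinv => l | UqGen.E => e | UqGen.F => f), by
      intro x y hxy
      cases hxy <;> simp [h₁, h₂, h₃, h₄, h₅]⟩

section lift
variable {B : Type} [Ring B] [Algebra Cq B] (k l e f : B) (h₁ : k * l = 1) (h₂ : l * k = 1)
    (h₃ : k * e = qq ^ 2 • (e * k)) (h₄ : k * f = (qq ^ 2)⁻¹ • (f * k))
    (h₅ : e * f - f * e = (qq - qq⁻¹)⁻¹ • (k - l))

theorem lift_K : lift k l e f h₁ h₂ h₃ h₄ h₅ K = k := by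
  unfold lift K gen mk
  erw [RingQuot.liftAlgHom_mkAlgHom_apply]
  simp

theorem lift_Kinv : lift k l e f h₁ h₂ h₃ h₄ h₅ Kinv = l := by
  unfold lift Kinv gen mk
  erw [RingQuot.liftAlgHom_mkAlgHom_apply]
  simp

theorem lift_E : lift k l e f h₁ h₂ h₃ h₄ h₅ E = e := by
  unfold lift E gen mk
  erw [RingQuot.liftAlgHom_mkAlgHom_apply]
  simp

theorem lift_F : lift k l e f h₁ h₂ h₃ h₄ h₅ F = f := by
  unfold lift F gen mk
  erw [RingQuot.liftAlgHom_mkAlgHom_apply]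
  simp

end lift

/-- Induction on the algebra generators. -/
theorem induction {P : Uq → Prop} (hc : ∀ r : Cq, P (algebraMap Cq Uq r)) (hK : P K) (hKi : P Kinv)
    (hE : P E) (hF : P F) (hm : ∀ a b, P a → P b → P (a * b)) (ha : ∀ a b, P a → P b → P (a + b))
    (x : Uq) : P x := by
  obtain ⟨y, rfl⟩ : ∃ y, mk y = x := RingQuot.mkAlgHom_surjective Cq UqRel x
  induction y using FreeAlgebra.induction with
  | grade0 r => rw [AlgHom.commutes]; exact hc r
  | grade1 g => cases g <;> assumption
  | mul a b h1 h2 => rw [map_mul]; exact hm _ _ h1 h2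
  | add a b h1 h2 => rw [map_add]; exact ha _ _ h1 h2

theorem Kinv_mul_E : Kinv * E = (qq ^ 2)⁻¹ • (E * Kinv) := by
  have h : Kinv * (K * E) * Kinv = Kinv * (qq ^ 2 • (E * K)) * Kinv := by rw [K_mul_E]
  have h1 : Kinv * (K * E) * Kinv = E * Kinv := by rw [← mul_assoc, Kinv_mul_K, one_mul]
  have h2 : Kinv * (qq ^ 2 • (E * K)) * Kinv = qq ^ 2 • (Kinv * E) := by
    rw [mul_smul_comm, smul_mul_assoc, mul_assoc, mul_assoc, K_mul_Kinv, mul_one]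
  rw [h1, h2] at h
  rw [h, inv_smul_smul₀ (pow_ne_zero 2 qq_ne_zero)]

theorem Kinv_mul_F : Kinv * F = qq ^ 2 • (F * Kinv) := by
  have h : Kinv * (K * F) * Kinv = Kinv * ((qq ^ 2)⁻¹ • (F * K)) * Kinv := by rw [K_mul_F]
  have h1 : Kinv * (K * F) * Kinv = F * Kinv := by rw [← mul_assoc, Kinv_mul_K, one_mul]
  have h2 : Kinv * ((qq ^ 2)⁻¹ • (F * K)) * Kinv = (qq ^ 2)⁻¹ • (Kinv * F) := by
    rw [mul_smul_comm, smul_mul_assoc, mul_assoc, mul_assoc, K_mul_Kinv, mul_one]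
  rw [h1, h2] at h
  rw [h, smul_inv_smul₀ (pow_ne_zero 2 qq_ne_zero)]

/-! ### Comultiplication, antipode, grading -/

/-- The comultiplication: `Δ(K) = K ⊗ K`, `Δ(E) = E ⊗ K + 1 ⊗ E`, `Δ(F) = F ⊗ 1 + K⁻¹ ⊗ F`. -/
def comul : Uq →ₐ[Cq] Uq ⊗[Cq] Uq :=
  lift (K ⊗ₜ K) (Kinv ⊗ₜ Kinv) (E ⊗ₜ K + 1 ⊗ₜ E) (F ⊗ₜ 1 + Kinv ⊗ₜ F)
    (by simp [K_mul_Kinv, Algebra.TensorProduct.one_def])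
    (by simp [Kinv_mul_K, Algebra.TensorProduct.one_def])
    (by simp [mul_add, add_mul, K_mul_E, TensorProduct.smul_tmul'])
    (by
      simp [mul_add, add_mul, K_mul_F, TensorProduct.smul_tmul', K_mul_Kinv, Kinv_mul_K])
    (by
      have h : (E ⊗ₜ[Cq] K + 1 ⊗ₜ E) * (F ⊗ₜ 1 + Kinv ⊗ₜ F) - (F ⊗ₜ 1 + Kinv ⊗ₜ F) * (E ⊗ₜ K + 1 ⊗ₜ E)
          = (E * F - F * E) ⊗ₜ[Cq] K + Kinv ⊗ₜ (E * F - F * E) := by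
        simp only [mul_add, add_mul, Algebra.TensorProduct.tmul_mul_tmul, mul_one, one_mul, K_mul_F,
          Kinv_mul_E, TensorProduct.tmul_smul, TensorProduct.smul_tmul', TensorProduct.tmul_sub,
          TensorProduct.sub_tmul]
        abel
      rw [h, E_F, TensorProduct.tmul_smul, ← TensorProduct.smul_tmul', ← smul_add,
        TensorProduct.sub_tmul, TensorProduct.tmul_sub]
      congr 1
      abel)

/-- The antipode, as an algebra map to the opposite algebra:
`S(K) = K⁻¹`, `S(E) = -E K⁻¹`, `S(F) = -K F`. -/
def antipode : Uq →ₐ[Cq] Uqᵐᵒᵖ :=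
  lift (MulOpposite.op Kinv) (MulOpposite.op K) (MulOpposite.op (-(E * Kinv)))
    (MulOpposite.op (-(K * F)))
    (by rw [← MulOpposite.op_mul, K_mul_Kinv, MulOpposite.op_one])
    (by rw [← MulOpposite.op_mul, Kinv_mul_K, MulOpposite.op_one])
    (by
      rw [← MulOpposite.op_mul, ← MulOpposite.op_mul, ← MulOpposite.op_smul]
      congr 1
      rw [mul_neg, neg_mul, smul_neg, ← mul_assoc Kinv, Kinv_mul_E, smul_mul_assoc,
        smul_inv_smul₀ (pow_ne_zero 2 qq_ne_zero)])
    (by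
      rw [← MulOpposite.op_mul, ← MulOpposite.op_mul, ← MulOpposite.op_smul]
      congr 1
      rw [mul_neg, neg_mul, smul_neg, ← mul_assoc Kinv, Kinv_mul_K, one_mul, K_mul_F,
        smul_mul_assoc, mul_assoc, K_mul_Kinv, mul_one])
    (by
      rw [← MulOpposite.op_mul, ← MulOpposite.op_mul, ← MulOpposite.op_sub, ← MulOpposite.op_sub,
        ← MulOpposite.op_smul]
      congr 1
      have h : K * (F * E) * Kinv = F * E := by
        rw [← mul_assoc, K_mul_F, smul_mul_assoc, mul_assoc F, K_mul_E, mul_smul_comm,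
          inv_smul_smul₀ (pow_ne_zero 2 qq_ne_zero), mul_assoc, mul_assoc, K_mul_Kinv, mul_one]
      have h' : E * Kinv * (K * F) = E * F := by
        rw [mul_assoc, ← mul_assoc Kinv, Kinv_mul_K, one_mul]
      have h'' : K * F * (E * Kinv) = F * E := by
        rw [← h]; simp only [mul_assoc]
      rw [neg_mul_neg, neg_mul_neg, h', h'', ← neg_sub, E_F, ← smul_neg, neg_sub])

/-- The `ℤ`-grading with `|E| = 1`, `|F| = -1`, `|K| = 0`, encoded as the algebra map
`U → U[T, T⁻¹]`, `x ↦ ∑ x_d T^d`, where `x_d` is the component of degree `d` of `x`. -/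
def grading : Uq →ₐ[Cq] AddMonoidAlgebra Uq ℤ :=
  lift (AddMonoidAlgebra.single 0 K) (AddMonoidAlgebra.single 0 Kinv) (AddMonoidAlgebra.single 1 E)
    (AddMonoidAlgebra.single (-1) F)
    (by rw [AddMonoidAlgebra.single_mul_single, K_mul_Kinv, add_zero, AddMonoidAlgebra.one_def])
    (by rw [AddMonoidAlgebra.single_mul_single, Kinv_mul_K, add_zero, AddMonoidAlgebra.one_def])
    (by
      rw [AddMonoidAlgebra.single_mul_single, AddMonoidAlgebra.single_mul_single, K_mul_E,
        AddMonoidAlgebra.smul_single, zero_add, add_zero])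
    (by
      rw [AddMonoidAlgebra.single_mul_single, AddMonoidAlgebra.single_mul_single, K_mul_F,
        AddMonoidAlgebra.smul_single, zero_add, add_zero])
    (by
      simp only [AddMonoidAlgebra.single_mul_single, add_neg_cancel, neg_add_cancel,
        ← AddMonoidAlgebra.single_sub, E_F, AddMonoidAlgebra.smul_single])

/-- The projection of `U_q(sl₂)` onto its component of degree `d`. -/
def proj (d : ℤ) : Uq →ₗ[Cq] Uq where
  toFun x := (grading x).coeff d
  map_add' x y := by simp
  map_smul' r x := by simp

/-! ### Left adjoint action and locally finite part -/

/-- The left adjoint action `h ▷ x = ∑ h₍₁₎ x S(h₍₂₎)`, as an algebra map `U → End(U)`. -/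
def ad : Uq →ₐ[Cq] Module.End Cq Uq :=
  (Algebra.TensorProduct.lift (Algebra.lsmul Cq Cq Uq)
    ((Algebra.lsmul Cq Cq Uq).comp antipode)
    (fun a b => by
      ext x
      simp [mul_assoc])).comp comul

/-- The submodule `U ▷ x`. -/
def orbit (x : Uq) : Submodule Cq Uq := LinearMap.range (ad.toLinearMap.flip x)

theorem ad_E (x : Uq) : ad E x = E * x * Kinv - x * (E * Kinv) := by
  unfold ad comul
  rw [AlgHom.comp_apply, lift_E]
  simp [antipode, lift_K, lift_E, sub_eq_add_neg, mul_assoc]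

theorem ad_F (x : Uq) : ad F x = F * x - Kinv * x * (K * F) := by
  unfold ad comul
  rw [AlgHom.comp_apply, lift_F]
  simp [antipode, lift_F, sub_eq_add_neg, mul_assoc]

theorem ad_K (x : Uq) : ad K x = K * x * Kinv := by
  unfold ad comul
  rw [AlgHom.comp_apply, lift_K]
  simp [antipode, lift_K, mul_assoc]

theorem ad_Kinv (x : Uq) : ad Kinv x = Kinv * x * K := by
  unfold ad comul
  rw [AlgHom.comp_apply, lift_Kinv]
  simp [antipode, lift_Kinv, mul_assoc]

theorem mem_orbit {x y : Uq} : y ∈ orbit x ↔ ∃ h, ad h x = y := Iff.rfl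

theorem self_mem_orbit (x : Uq) : x ∈ orbit x := mem_orbit.2 ⟨1, by simp⟩

theorem ad_mem_orbit {x y : Uq} (h : Uq) (hy : y ∈ orbit x) : ad h y ∈ orbit x := by
  obtain ⟨g, rfl⟩ := hy
  exact ⟨h * g, by simp⟩

theorem finite_orbit_of_le {x : Uq} {V : Submodule Cq Uq} (hV : FiniteDimensional Cq V)
    (hx : x ∈ V) (hs : ∀ h, ∀ v ∈ V, ad h v ∈ V) : FiniteDimensional Cq (orbit x) := by
  have hle : orbit x ≤ V := by
    rintro _ ⟨h, rfl⟩
    exact hs h x hx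
  exact Submodule.finiteDimensional_of_le hle

theorem stable_of_gens {V : Submodule Cq Uq} (hK : ∀ v ∈ V, ad K v ∈ V)
    (hKi : ∀ v ∈ V, ad Kinv v ∈ V) (hE : ∀ v ∈ V, ad E v ∈ V) (hF : ∀ v ∈ V, ad F v ∈ V) (h : Uq) :
    ∀ v ∈ V, ad h v ∈ V := by
  induction h using Uq.induction with
  | hc r =>
    intro v hv
    rw [AlgHom.commutes]
    exact V.smul_mem r hv
  | hK => exact hK
  | hKi => exact hKi
  | hE => exact hE
  | hF => exact hF
  | hm a b h1 h2 =>
    intro v hv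
    rw [map_mul]
    exact h1 _ (h2 v hv)
  | ha a b h1 h2 =>
    intro v hv
    rw [map_add]
    exact V.add_mem (h1 v hv) (h2 v hv)

theorem ad_K_mul (x y : Uq) : ad K (x * y) = ad K x * ad K y := by
  have h : K * x * Kinv * (K * y * Kinv) = K * x * (Kinv * K) * y * Kinv := by
    simp only [mul_assoc]
  rw [ad_K, ad_K, ad_K, h, Kinv_mul_K]
  simp only [mul_assoc, one_mul]

theorem ad_Kinv_mul (x y : Uq) : ad Kinv (x * y) = ad Kinv x * ad Kinv y := by
  have h : Kinv * x * K * (Kinv * y * K) = Kinv * x * (K * Kinv) * y * K := by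
    simp only [mul_assoc]
  rw [ad_Kinv, ad_Kinv, ad_Kinv, h, K_mul_Kinv]
  simp only [mul_assoc, one_mul]

theorem ad_E_mul (x y : Uq) : ad E (x * y) = ad E x * ad K y + x * ad E y := by
  have h : (E * x * Kinv - x * (E * Kinv)) * (K * y * Kinv) =
      E * x * (Kinv * K) * y * Kinv - x * E * (Kinv * K) * y * Kinv := by
    simp only [mul_assoc, sub_mul]
  rw [ad_K, ad_E, ad_E, ad_E, h, Kinv_mul_K]
  simp only [mul_assoc, one_mul, mul_sub]
  abel

theorem ad_F_mul (x y : Uq) : ad F (x * y) = ad F x * y + ad Kinv x * ad F y := by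
  have h : Kinv * x * K * (F * y - Kinv * y * (K * F)) =
      Kinv * x * K * F * y - Kinv * x * (K * Kinv) * y * (K * F) := by
    simp only [mul_assoc, mul_sub]
  rw [ad_F, ad_F, ad_F, ad_Kinv, h, K_mul_Kinv]
  simp only [mul_assoc, mul_one, sub_mul]
  abel

theorem stable_mul {V W : Submodule Cq Uq} (hV : ∀ h, ∀ v ∈ V, ad h v ∈ V)
    (hW : ∀ h, ∀ v ∈ W, ad h v ∈ W) (h : Uq) : ∀ v ∈ V * W, ad h v ∈ V * W := by
  have key : ∀ g : Uq, (∀ x ∈ V, ∀ y ∈ W, ad g (x * y) ∈ V * W) → ∀ v ∈ V * W, ad g v ∈ V * W := by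
    intro g hg v hv
    induction hv using Submodule.mul_induction_on' with
    | mem_mul_mem x hx y hy => exact hg x hx y hy
    | add x _ y _ h1 h2 => rw [map_add]; exact Submodule.add_mem _ h1 h2
  refine stable_of_gens (key _ ?_) (key _ ?_) (key _ ?_) (key _ ?_) h <;> intro x hx y hy
  · rw [ad_K_mul]
    exact Submodule.mul_mem_mul (hV _ _ hx) (hW _ _ hy)
  · rw [ad_Kinv_mul]
    exact Submodule.mul_mem_mul (hV _ _ hx) (hW _ _ hy)
  · rw [ad_E_mul]
    exact Submodule.add_mem _ (Submodule.mul_mem_mul (hV _ _ hx) (hW _ _ hy))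
      (Submodule.mul_mem_mul hx (hW _ _ hy))
  · rw [ad_F_mul]
    exact Submodule.add_mem _ (Submodule.mul_mem_mul (hV _ _ hx) hy)
      (Submodule.mul_mem_mul (hV _ _ hx) (hW _ _ hy))

/-- The locally finite part `{x | U ▷ x is finite dimensional}`, a subalgebra of `U_q(sl₂)`. -/
def lf : Subalgebra Cq Uq where
  carrier := {x | FiniteDimensional Cq (orbit x)}
  mul_mem' {x y} hx hy := by
    have hx' : (orbit x).FG := (Submodule.fg_iff_finiteDimensional _).2 hx
    have hy' : (orbit y).FG := (Submodule.fg_iff_finiteDimensional _).2 hy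
    exact finite_orbit_of_le ((Submodule.fg_iff_finiteDimensional _).1 (hx'.mul hy'))
      (Submodule.mul_mem_mul (self_mem_orbit x) (self_mem_orbit y))
      (stable_mul (fun h _ hv => ad_mem_orbit h hv) (fun h _ hv => ad_mem_orbit h hv))
  add_mem' {x y} hx hy := by
    have hx' : (orbit x).FG := (Submodule.fg_iff_finiteDimensional _).2 hx
    have hy' : (orbit y).FG := (Submodule.fg_iff_finiteDimensional _).2 hy
    refine finite_orbit_of_le ((Submodule.fg_iff_finiteDimensional _).1 (hx'.sup hy'))
      (Submodule.add_mem_sup (self_mem_orbit x) (self_mem_orbit y)) ?_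
    intro h v hv
    obtain ⟨a, ha, b, hb, rfl⟩ := Submodule.mem_sup.1 hv
    rw [map_add]
    exact Submodule.add_mem_sup (ad_mem_orbit h ha) (ad_mem_orbit h hb)
  algebraMap_mem' r := by
    have hfd : FiniteDimensional Cq (Submodule.span Cq {(1 : Uq)}) := inferInstance
    have h1 : (1 : Uq) ∈ Submodule.span Cq {(1 : Uq)} := Submodule.subset_span rfl
    refine finite_orbit_of_le hfd ?_ ?_
    · rw [Algebra.algebraMap_eq_smul_one]
      exact Submodule.smul_mem _ _ h1
    · have key : ∀ g : Uq, ad g 1 ∈ Submodule.span Cq {(1 : Uq)} →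
          ∀ v ∈ Submodule.span Cq {(1 : Uq)}, ad g v ∈ Submodule.span Cq {(1 : Uq)} := by
        intro g hg v hv
        obtain ⟨c, rfl⟩ := Submodule.mem_span_singleton.1 hv
        rw [map_smul]
        exact Submodule.smul_mem _ _ hg
      refine stable_of_gens (key _ ?_) (key _ ?_) (key _ ?_) (key _ ?_)
      · rw [ad_K, mul_one, K_mul_Kinv]; exact h1
      · rw [ad_Kinv, mul_one, Kinv_mul_K]; exact h1
      · rw [ad_E, mul_one, one_mul, sub_self]; exact Submodule.zero_mem _
      · rw [ad_F, mul_one, mul_one, ← mul_assoc, Kinv_mul_K, one_mul, sub_self]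
        exact Submodule.zero_mem _

theorem mem_lf {x : Uq} : x ∈ lf ↔ FiniteDimensional Cq (orbit x) := Iff.rfl

theorem ad_mem_lf (h : Uq) {x : Uq} (hx : x ∈ lf) : ad h x ∈ lf :=
  finite_orbit_of_le (mem_lf.1 hx) (ad_mem_orbit h (self_mem_orbit x))
    (fun _ _ hv => ad_mem_orbit _ hv)

/-- The left adjoint action of `U_q(sl₂)` on its locally finite part. -/
def lfAct : Uq →ₐ[Cq] Module.End Cq lf where
  toFun h := (ad h).restrict (p := Subalgebra.toSubmodule lf) (q := Subalgebra.toSubmodule lf)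
    (fun _ hx => ad_mem_lf h hx)
  map_one' := by ext x; simp
  map_mul' g h := by ext x; simp
  map_zero' := by ext x; simp
  map_add' g h := by ext x; simp
  commutes' r := by
    ext x
    simp only [AlgHom.commutes]
    rfl

theorem lfAct_coe (h : Uq) (x : lf) : ((lfAct h x : lf) : Uq) = ad h x := rfl

/-- Homogeneous elements span, and they are weight vectors for the adjoint action of `K`. -/
theorem mem_span_homogeneous (x : Uq) : x ∈ Submodule.span Cq
    {y : Uq | ∃ d : ℤ, grading y = AddMonoidAlgebra.single d y ∧ K * y = qq ^ (2 * d) • (y * K)} := by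
  induction x using Uq.induction with
  | hc r =>
    rw [Algebra.algebraMap_eq_smul_one]
    refine Submodule.smul_mem _ _ (Submodule.subset_span ⟨0, ?_, ?_⟩)
    · rw [map_one, AddMonoidAlgebra.one_def]
    · simp
  | hK => exact Submodule.subset_span ⟨0, lift_K .., by simp⟩
  | hKi =>
    exact Submodule.subset_span ⟨0, lift_Kinv .., by simp [K_mul_Kinv, Kinv_mul_K]⟩
  | hE => exact Submodule.subset_span ⟨1, lift_E .., by rw [K_mul_E]; norm_cast⟩
  | hF =>
    refine Submodule.subset_span ⟨-1, lift_F .., ?_⟩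
    rw [K_mul_F]
    congr 1
  | hm a b h1 h2 =>
    have h := Submodule.mul_mem_mul h1 h2
    rw [Submodule.span_mul_span] at h
    refine Submodule.span_mono ?_ h
    rintro _ ⟨y, ⟨d, hd, hd'⟩, z, ⟨e, he, he'⟩, rfl⟩
    refine ⟨d + e, ?_, ?_⟩
    · simp only [map_mul, hd, he, AddMonoidAlgebra.single_mul_single]
    · simp only
      rw [← mul_assoc, hd', smul_mul_assoc, mul_assoc, he', mul_smul_comm, smul_smul, mul_assoc,
        ← zpow_add₀ qq_ne_zero, mul_add]
  | ha a b h1 h2 => exact Submodule.add_mem _ h1 h2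

theorem proj_of_homogeneous {y : Uq} {d : ℤ} (h : grading y = AddMonoidAlgebra.single d y) (e : ℤ) :
    proj e y = if e = d then y else 0 := by
  have : proj e y = (grading y).coeff e := rfl
  rw [this, h, AddMonoidAlgebra.coeff_single, Finsupp.single_apply]
  simp only [eq_comm]

theorem ad_K_proj (x : Uq) (d : ℤ) : ad K (proj d x) = qq ^ (2 * d) • proj d x := by
  induction mem_span_homogeneous x using Submodule.span_induction with
  | mem y hy =>
    obtain ⟨e, he, he'⟩ := hy
    rw [proj_of_homogeneous he]
    split_ifs with h
    · subst h
      rw [ad_K, he', smul_mul_assoc, mul_assoc, K_mul_Kinv, mul_one]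
    · simp
  | zero => simp
  | add y z _ _ h1 h2 => rw [map_add, map_add, h1, h2, smul_add]
  | smul c y _ h => rw [map_smul, map_smul, h, smul_comm]

theorem ad_E_proj (x : Uq) (d : ℤ) : ad E (proj d x) = proj (d + 1) (ad E x) := by
  induction mem_span_homogeneous x using Submodule.span_induction with
  | mem y hy =>
    obtain ⟨e, he, -⟩ := hy
    have h : grading (ad E y) = AddMonoidAlgebra.single (e + 1) (ad E y) := by
      have hE : grading E = AddMonoidAlgebra.single 1 E := lift_E ..
      have hK : grading Kinv = AddMonoidAlgebra.single 0 Kinv := lift_Kinv ..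
      rw [ad_E, map_sub, map_mul, map_mul, map_mul, map_mul, hE, hK, he,
        AddMonoidAlgebra.single_mul_single, AddMonoidAlgebra.single_mul_single,
        AddMonoidAlgebra.single_mul_single, AddMonoidAlgebra.single_mul_single,
        AddMonoidAlgebra.single_sub, add_zero, add_zero, add_comm 1 e]
    rw [proj_of_homogeneous h, proj_of_homogeneous he]
    by_cases hd : d = e
    · simp [hd]
    · simp [hd]
  | zero => simp
  | add y z _ _ h1 h2 => simp only [map_add, h1, h2]
  | smul c y _ h => simp only [map_smul, h]

theorem proj_finite (x : Uq) : {d | proj d x ≠ 0}.Finite :=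
  (grading x).coeff.hasFiniteSupport

theorem finsum_proj (x : Uq) : ∑ᶠ d, proj d x = x := by
  induction mem_span_homogeneous x using Submodule.span_induction with
  | mem y hy =>
    obtain ⟨e, he, -⟩ := hy
    simp only [proj_of_homogeneous he]
    rw [finsum_eq_single _ e (fun n hn => if_neg hn), if_pos rfl]
  | zero => simp
  | add y z _ _ h1 h2 =>
    simp only [map_add]
    rw [finsum_add_distrib (proj_finite y) (proj_finite z), h1, h2]
  | smul c y _ h =>
    simp only [map_smul]
    rw [← smul_finsum' c (proj_finite y), h]

theorem qq_zpow_injective : Function.Injective (fun d : ℤ => qq ^ (2 * d)) := by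
  have hn : ∀ n : ℕ, (qq ^ n).intDegree = n := by
    intro n
    induction n with
    | zero => simp
    | succ n ih =>
      rw [pow_succ, RatFunc.intDegree_mul (pow_ne_zero n qq_ne_zero) qq_ne_zero, ih]
      simp [qq]
  have hz : ∀ n : ℤ, (qq ^ n).intDegree = n := by
    intro n
    obtain ⟨m, rfl | rfl⟩ := n.eq_nat_or_neg
    · rw [zpow_natCast, hn]
    · rw [zpow_neg, zpow_natCast, RatFunc.intDegree_inv, hn]
  intro a b hab
  have h := congrArg RatFunc.intDegree hab
  simp only [hz] at h
  omega

theorem exists_poly (s : Finset ℤ) (d : ℤ) (hd : d ∈ s) : ∃ p : Polynomial Cq,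
    p.eval (qq ^ (2 * d)) = 1 ∧ ∀ e ∈ s, e ≠ d → p.eval (qq ^ (2 * e)) = 0 := by
  classical
  have hinj := qq_zpow_injective
  generalize hw : (fun d : ℤ => qq ^ (2 * d)) = w at hinj
  have hw' : ∀ e : ℤ, qq ^ (2 * e) = w e := fun e => congrFun hw e
  simp only [hw']
  exact ⟨Lagrange.basis s w d, Lagrange.eval_basis_self hinj.injOn hd,
    fun e he hne => Lagrange.eval_basis_of_ne hne.symm he⟩

/-- Components of `x` lie in `U ▷ x`. -/
theorem proj_mem_orbit (x : Uq) (d : ℤ) : proj d x ∈ orbit x := by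
  classical
  by_cases hd : proj d x = 0
  · rw [hd]; exact Submodule.zero_mem _
  have hsum : ∑ e ∈ (proj_finite x).toFinset, proj e x = x := by
    rw [← finsum_eq_sum_of_support_subset, finsum_proj]
    intro e he
    simpa using he
  obtain ⟨p, h1, h0⟩ := exists_poly (proj_finite x).toFinset d (by simpa using hd)
  have hp : ∀ e, ad (Polynomial.aeval K p) (proj e x) = p.eval (qq ^ (2 * e)) • proj e x := by
    intro e
    rw [← Polynomial.aeval_algHom_apply]
    exact Module.End.aeval_apply_of_mem_apply_eq_smul (ad_K_proj x e)
  refine mem_orbit.2 ⟨Polynomial.aeval K p, ?_⟩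
  conv_lhs => rw [← hsum]
  rw [map_sum, Finset.sum_eq_single d]
  · rw [hp, h1, one_smul]
  · intro e he hne
    rw [hp, h0 e he hne, zero_smul]
  · intro h
    simp at h
    rw [h, map_zero]

/-- The projections of the locally finite part onto its homogeneous components. -/
def lfProj (d : ℤ) : Module.End Cq lf :=
  (proj d).restrict (p := Subalgebra.toSubmodule lf) (q := Subalgebra.toSubmodule lf)
    (fun x hx => by
      obtain ⟨h, hh⟩ := mem_orbit.1 (proj_mem_orbit x d)
      rw [← hh]
      exact ad_mem_lf h hx)

theorem lfProj_coe (d : ℤ) (x : lf) : ((lfProj d x : lf) : Uq) = proj d x := rfl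

theorem lfProj_finite (x : lf) : {d | lfProj d x ≠ 0}.Finite := by
  refine (proj_finite x).subset (fun d hd h => hd (Subtype.ext ?_))
  exact h

/-- `E` acts locally nilpotently on the locally finite part. -/
theorem lfAct_E_nilpotent (x : lf) : ∃ N : ℕ, ∀ i ≥ N, lfAct (E ^ i) x = 0 := by
  obtain ⟨x, hx⟩ := x
  have hcomm : ∀ (i : ℕ) (e : ℤ), ad (E ^ i) (proj e x) = proj (e + i) (ad (E ^ i) x) := by
    intro i
    induction i with
    | zero => intro e; simp
    | succ i ih =>
      intro e
      rw [pow_succ', map_mul, Module.End.mul_apply, Module.End.mul_apply, ih, ad_E_proj]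
      congr 2
      push_cast
      ring
  obtain ⟨s, hs⟩ := (Submodule.fg_iff_finiteDimensional _).2 (mem_lf.1 hx)
  obtain ⟨B, hB⟩ : ∃ B : ℤ, ∀ y ∈ orbit x, ∀ d > B, proj d y = 0 := by
    obtain ⟨B, hB⟩ := (s.finite_toSet.biUnion (fun y _ => proj_finite y)).bddAbove
    refine ⟨B, fun y hy d hd => ?_⟩
    rw [← hs] at hy
    induction hy using Submodule.span_induction with
    | mem y hy =>
      by_contra hne
      exact absurd (hB (Set.mem_biUnion hy hne)) (not_le.2 hd)
    | zero => simp
    | add y z _ _ h1 h2 => rw [map_add, h1, h2, add_zero]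
    | smul c y _ h => rw [map_smul, h, smul_zero]
  obtain ⟨L, hL⟩ := (proj_finite x).bddBelow
  refine ⟨(B - L + 1).toNat, fun i hi => Subtype.ext ?_⟩
  rw [lfAct_coe]
  change ad (E ^ i) x = 0
  rw [← finsum_proj (ad (E ^ i) x)]
  refine (finsum_congr fun e => ?_).trans finsum_zero
  by_cases he : B < e
  · exact hB _ (ad_mem_orbit _ (self_mem_orbit x)) e he
  · have h := hcomm i (e - i)
    rw [sub_add_cancel] at h
    rw [← h]
    have h0 : proj (e - i) x = 0 := by
      by_contra hne
      have h1 : L ≤ e - i := hL hne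
      omega
    rw [h0, map_zero]

/-! ### The quasi-R-matrix -/

/-- `K` as a unit, so that `Kᵐ` makes sense for `m : ℤ`. -/
def Kunit : Uqˣ := ⟨K, Kinv, K_mul_Kinv, Kinv_mul_K⟩

/-- The power `Kᵐ` for `m : ℤ`. -/
def Kz (m : ℤ) : Uq := ((Kunit ^ m : Uqˣ) : Uq)

/-- The `q`-number `[n] = (qⁿ - q⁻ⁿ) / (q - q⁻¹)`. -/
def qNum (n : ℕ) : Cq := (qq ^ n - (qq ^ n)⁻¹) / (qq - qq⁻¹)

/-- The `q`-factorial `[n]! = [1][2]⋯[n]`. -/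
def qFact (n : ℕ) : Cq := ∏ j ∈ Finset.range n, qNum (j + 1)

/-- The first leg `u_i = E^i` of `Θ_i = u_i ⊗ v_i`. -/
def u (i : ℕ) : Uq := E ^ i

/-- The second leg `v_i` of `Θ_i = u_i ⊗ v_i = q^{i(i-1)/2} (q - q⁻¹)^i / [i]! • E^i ⊗ F^i`. -/
def v (i : ℕ) : Uq := (qq ^ (i * (i - 1) / 2) * (qq - qq⁻¹) ^ i / qFact i) • F ^ i

end Uq

/-! ### Braided tensor products -/

/-- The sum of a family of linear maps, only finitely many of which are nonzero at each vector. -/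
def locSum {ι M P : Type} [AddCommGroup M] [Module Cq M] [AddCommGroup P] [Module Cq P]
    (f : ι → M →ₗ[Cq] P) (hf : ∀ m, (Function.support fun i => f i m).Finite) : M →ₗ[Cq] P where
  toFun m := ∑ᶠ i, f i m
  map_add' x y := by
    simp only [map_add]
    exact finsum_add_distrib (hf x) (hf y)
  map_smul' c x := by
    simp only [map_smul, RingHom.id_apply]
    exact (smul_finsum' c (hf x)).symm

/-- For families of maps out of a tensor product it is enough to check pure tensors. -/
theorem finite_support_tensor {ι M N P : Type} [AddCommGroup M] [Module Cq M] [AddCommGroup N]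
    [Module Cq N] [AddCommGroup P] [Module Cq P] (f : ι → M ⊗[Cq] N →ₗ[Cq] P)
    (hf : ∀ m n, (Function.support fun i => f i (m ⊗ₜ n)).Finite) (t : M ⊗[Cq] N) :
    (Function.support fun i => f i t).Finite := by
  induction t using TensorProduct.induction_on with
  | zero => simp [Function.support]
  | tmul m n => exact hf m n
  | add x y hx hy =>
    refine (hx.union hy).subset ?_
    intro i hi
    by_contra hn
    simp only [Set.mem_union, Function.mem_support, not_or, not_not] at hn
    exact hi (by simp only [map_add, hn.1, hn.2, add_zero])

/-- The data carried by a braided tensor power: a `ℂ(q)`-vector space with an action of `U_q(sl₂)`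
for which `E` is locally nilpotent, the projections onto the homogeneous components for the
`ℤ`-grading, a bilinear product and a unit. -/
structure BrObj where
  carrier : Type
  [addCommGroup : AddCommGroup carrier]
  [module : Module Cq carrier]
  act : Uq →ₐ[Cq] Module.End Cq carrier
  proj : ℤ → Module.End Cq carrier
  proj_finite : ∀ m, {d | proj d m ≠ 0}.Finite
  E_nilpotent : ∀ m, ∃ N : ℕ, ∀ i ≥ N, act (Uq.E ^ i) m = 0
  mul : carrier →ₗ[Cq] carrier →ₗ[Cq] carrier
  one : carrier

namespace BrObj

instance (X : BrObj) : AddCommGroup X.carrier := X.addCommGroup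
instance (X : BrObj) : Module Cq X.carrier := X.module

/-- The locally finite part of `U_q(sl₂)`, with the left adjoint action, the grading and the
product inherited from `U_q(sl₂)`. -/
def lf : BrObj where
  carrier := Uq.lf
  act := Uq.lfAct
  proj := Uq.lfProj
  proj_finite := Uq.lfProj_finite
  E_nilpotent := Uq.lfAct_E_nilpotent
  mul := LinearMap.mul Cq Uq.lf
  one := 1

variable (X Y : BrObj)

theorem finite_u_proj (y : Y.carrier) :
    {p : ℕ × ℤ | Y.act (Uq.u p.1) (Y.proj p.2 y) ≠ 0}.Finite := by
  choose N hN using Y.E_nilpotent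
  refine ((Y.proj_finite y).biUnion fun d _ =>
    (Set.finite_Iio (N (Y.proj d y))).prod (Set.finite_singleton d)).subset ?_
  rintro ⟨i, d⟩ hp
  have hp' : Y.act (Uq.E ^ i) (Y.proj d y) ≠ 0 := hp
  refine Set.mem_biUnion (x := d) (fun h0 => hp' (by rw [h0, map_zero])) ⟨?_, rfl⟩
  by_contra hi
  exact hp' (hN _ i (not_lt.1 hi))

/-- The action of `U_q(sl₂)` on a tensor product, through the comultiplication:
`h ▷ (x ⊗ y) = ∑ h₍₁₎ ▷ x ⊗ h₍₂₎ ▷ y`. -/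
def tensorAct : Uq →ₐ[Cq] Module.End Cq (X.carrier ⊗[Cq] Y.carrier) :=
  (Module.endTensorEndAlgHom (R := Cq) (S := Cq) (A := Cq)).comp
    ((Algebra.TensorProduct.map X.act Y.act).comp Uq.comul)

theorem tensorAct_E (x : X.carrier) (y : Y.carrier) :
    tensorAct X Y Uq.E (x ⊗ₜ y) = X.act Uq.E x ⊗ₜ Y.act Uq.K y + x ⊗ₜ Y.act Uq.E y := by
  unfold tensorAct Uq.comul
  rw [AlgHom.comp_apply, AlgHom.comp_apply, Uq.lift_E]
  simp [Module.endTensorEndAlgHom_apply]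

theorem tensorAct_E_nilpotent (t : X.carrier ⊗[Cq] Y.carrier) :
    ∃ N : ℕ, ∀ i ≥ N, tensorAct X Y (Uq.E ^ i) t = 0 := by
  induction t using TensorProduct.induction_on with
  | zero => exact ⟨0, fun i _ => map_zero _⟩
  | add s t hs ht =>
    obtain ⟨N, hN⟩ := hs
    obtain ⟨N', hN'⟩ := ht
    refine ⟨max N N', fun i hi => ?_⟩
    rw [map_add, hN i (le_of_max_le_left hi), hN' i (le_of_max_le_right hi), add_zero]
  | tmul x y =>
    let T : ℕ → Set (X.carrier ⊗[Cq] Y.carrier) := fun i =>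
      {t | ∃ a b c : ℕ, a + b = i ∧ t = X.act (Uq.E ^ a) x ⊗ₜ Y.act (Uq.K ^ c * Uq.E ^ b) y}
    have hEK : ∀ c : ℕ, Uq.E * Uq.K ^ c = ((qq ^ 2)⁻¹) ^ c • (Uq.K ^ c * Uq.E) := by
      have h1 : Uq.E * Uq.K = (qq ^ 2)⁻¹ • (Uq.K * Uq.E) := by
        rw [Uq.K_mul_E, inv_smul_smul₀ (pow_ne_zero 2 Uq.qq_ne_zero)]
      intro c
      induction c with
      | zero => simp
      | succ c ih =>
        rw [pow_succ, ← mul_assoc, ih, smul_mul_assoc, mul_assoc, h1, mul_smul_comm, smul_smul,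
          ← mul_assoc, ← pow_succ]
    have hmem : ∀ i, tensorAct X Y (Uq.E ^ i) (x ⊗ₜ y) ∈ Submodule.span Cq (T i) := by
      intro i
      induction i with
      | zero => exact Submodule.subset_span ⟨0, 0, 0, rfl, by simp⟩
      | succ i ih =>
        rw [pow_succ', map_mul, Module.End.mul_apply]
        generalize tensorAct X Y (Uq.E ^ i) (x ⊗ₜ y) = t at ih ⊢
        induction ih using Submodule.span_induction with
        | mem t ht =>
          obtain ⟨a, b, c, rfl, rfl⟩ := ht
          rw [tensorAct_E]
          refine Submodule.add_mem _ (Submodule.subset_span ⟨a + 1, b, c + 1, by omega, ?_⟩) ?_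
          · rw [← Module.End.mul_apply, ← Module.End.mul_apply, ← map_mul, ← map_mul,
              ← pow_succ', ← mul_assoc, ← pow_succ']
          · rw [← Module.End.mul_apply, ← map_mul, ← mul_assoc, hEK, smul_mul_assoc, map_smul,
              LinearMap.smul_apply, TensorProduct.tmul_smul]
            refine Submodule.smul_mem _ _ (Submodule.subset_span ⟨a, b + 1, c, by omega, ?_⟩)
            rw [mul_assoc, ← pow_succ']
        | zero => rw [map_zero]; exact Submodule.zero_mem _
        | add s t _ _ h1 h2 => rw [map_add]; exact Submodule.add_mem _ h1 h2
        | smul c t _ h => rw [map_smul]; exact Submodule.smul_mem _ _ h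
    obtain ⟨N, hN⟩ := X.E_nilpotent x
    obtain ⟨N', hN'⟩ := Y.E_nilpotent y
    refine ⟨N + N', fun i hi => ?_⟩
    have hT : T i ⊆ {0} := by
      rintro _ ⟨a, b, c, hab, rfl⟩
      by_cases ha : N ≤ a
      · rw [hN a ha, TensorProduct.zero_tmul]; rfl
      · rw [map_mul, Module.End.mul_apply, hN' b (by omega), map_zero, TensorProduct.tmul_zero]
        rfl
    have h := Submodule.span_mono hT (hmem i)
    simpa using h

/-- The total grading on a tensor product: the component of degree `d` of `x ⊗ y` is
`∑_e x_e ⊗ y_{d-e}`. -/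
def tensorProj (d : ℤ) : Module.End Cq (X.carrier ⊗[Cq] Y.carrier) :=
  locSum (fun e : ℤ => TensorProduct.map (X.proj e) (Y.proj (d - e)))
    (finite_support_tensor _ fun x y => (X.proj_finite x).subset fun e he h0 => he (by
      simp only [TensorProduct.map_tmul, h0, TensorProduct.zero_tmul]))

theorem tensorProj_finite (t : X.carrier ⊗[Cq] Y.carrier) :
    {d | tensorProj X Y d t ≠ 0}.Finite := by
  refine finite_support_tensor (tensorProj X Y) (fun x y => ?_) t
  refine ((X.proj_finite x).image2 (fun a b : ℤ => a + b) (Y.proj_finite y)).subset ?_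
  intro d hd
  by_contra hn
  refine hd ((finsum_congr fun e => ?_).trans finsum_zero)
  rw [TensorProduct.map_tmul]
  by_cases he : X.proj e x = 0
  · rw [he, TensorProduct.zero_tmul]
  · by_cases he' : Y.proj (d - e) y = 0
    · rw [he', TensorProduct.tmul_zero]
    · exact absurd ⟨e, he, d - e, he', add_sub_cancel e d⟩ hn

/-- The braiding `X ⊗ Y → Y ⊗ X`: for homogeneous `x`, `y` it is
`x ⊗ y ↦ ∑_i q^{2(|x|+i)(|y|-i)} (v_i ▷ y) ⊗ (u_i ▷ x)`. In general one sums over `(i, d, e)` the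
contributions of the components `x_d` and `y_e`. -/
def braiding : X.carrier ⊗[Cq] Y.carrier →ₗ[Cq] Y.carrier ⊗[Cq] X.carrier :=
  locSum (fun p : ℕ × ℤ × ℤ =>
      qq ^ (2 * (p.2.1 + p.1) * (p.2.2 - p.1)) •
        ((TensorProduct.map (Y.act (Uq.v p.1) ∘ₗ Y.proj p.2.2) (X.act (Uq.u p.1) ∘ₗ X.proj p.2.1))
          ∘ₗ (TensorProduct.comm Cq X.carrier Y.carrier).toLinearMap))
    (finite_support_tensor _ fun x y => by
      refine (((finite_u_proj X x).prod (Y.proj_finite y)).image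
        (fun p : (ℕ × ℤ) × ℤ => (p.1.1, p.1.2, p.2))).subset ?_
      rintro ⟨i, d, e⟩ hp
      refine ⟨((i, d), e), ⟨fun h0 => hp ?_, fun h0 => hp ?_⟩, rfl⟩
      · simp only at h0
        simp [h0]
      · simp only at h0
        simp [h0])

/-- The braided product on `X ⊗ Y`: for homogeneous elements
`(g ⊗ h) · (x ⊗ y) = ∑_i q^{2(|h|+i)(|x|-i)} g (v_i ▷ x) ⊗ (u_i ▷ h) y`,
that is: apply the braiding to `h ⊗ x`, then multiply in `X` and in `Y`. -/
def braidedMul : X.carrier ⊗[Cq] Y.carrier →ₗ[Cq]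
    X.carrier ⊗[Cq] Y.carrier →ₗ[Cq] X.carrier ⊗[Cq] Y.carrier :=
  TensorProduct.curry
    (TensorProduct.map (TensorProduct.lift X.mul) (TensorProduct.lift Y.mul)
      ∘ₗ (TensorProduct.assoc Cq X.carrier X.carrier (Y.carrier ⊗[Cq] Y.carrier)).symm.toLinearMap
      ∘ₗ (TensorProduct.assoc Cq X.carrier Y.carrier Y.carrier).toLinearMap.lTensor X.carrier
      ∘ₗ ((braiding Y X).rTensor Y.carrier).lTensor X.carrier
      ∘ₗ (TensorProduct.assoc Cq Y.carrier X.carrier Y.carrier).symm.toLinearMap.lTensor X.carrier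
      ∘ₗ (TensorProduct.assoc Cq X.carrier Y.carrier (X.carrier ⊗[Cq] Y.carrier)).toLinearMap)

/-- The braided tensor product of `X` and `Y`. -/
def tensor : BrObj where
  carrier := X.carrier ⊗[Cq] Y.carrier
  act := tensorAct X Y
  proj := tensorProj X Y
  proj_finite := tensorProj_finite X Y
  E_nilpotent := tensorAct_E_nilpotent X Y
  mul := braidedMul X Y
  one := X.one ⊗ₜ Y.one

/-- `y ↦ ∑_i K^{i+|y|} v_i ⊗ (u_i ▷ y)` for homogeneous `y`, extended linearly: in general one sums
over `(i, d)` the contributions of the components `y_d`. -/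
def unbraidAux : Y.carrier →ₗ[Cq] Uq ⊗[Cq] Y.carrier :=
  locSum (fun p : ℕ × ℤ =>
      TensorProduct.mk Cq Uq Y.carrier (Uq.Kz (p.1 + p.2) * Uq.v p.1)
        ∘ₗ Y.act (Uq.u p.1) ∘ₗ Y.proj p.2)
    (fun y => (finite_u_proj Y y).subset fun p hp h0 => hp (by
      simp only [LinearMap.comp_apply, h0, map_zero]))

/-- The one-step unbraiding map `a ⊗ y ↦ ∑_i a K^{i+|y|} v_i ⊗ (u_i ▷ y)` (for homogeneous `y`), from
the braided tensor product of the locally finite part with `Y`, to `U_q(sl₂) ⊗ Y`. -/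
def unbraid : (tensor lf Y).carrier →ₗ[Cq] Uq ⊗[Cq] Y.carrier :=
  TensorProduct.lift
    ((LinearMap.lcomp Cq (Uq ⊗[Cq] Y.carrier) (unbraidAux Y)) ∘ₗ
      (LinearMap.rTensorHom Y.carrier) ∘ₗ (LinearMap.mul Cq Uq) ∘ₗ Uq.lf.val.toLinearMap)

/-- The product of the ordinary tensor product `U_q(sl₂) ⊗ Y`: `(g ⊗ x)(h ⊗ y) = gh ⊗ xy`. -/
def ordMul : Uq ⊗[Cq] Y.carrier →ₗ[Cq] Uq ⊗[Cq] Y.carrier →ₗ[Cq] Uq ⊗[Cq] Y.carrier :=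
  TensorProduct.map₂ (LinearMap.mul Cq Uq) Y.mul

end BrObj

/-- The braided tensor power `(U_q(sl₂)^lf)^{⊗̃ (m+1)}`: note the shift, index `0` is the first
power. -/
def brPow : ℕ → BrObj
  | 0 => BrObj.lf
  | m + 1 => BrObj.tensor BrObj.lf (brPow m)

/-- The ordinary tensor power `U_q(sl₂)^{⊗ (m+1)}`, as an algebra: note the shift, index `0` is the
first power. -/
def uqPow : ℕ → AlgCat.{0} Cq
  | 0 => AlgCat.of Cq Uq
  | m + 1 => AlgCat.of Cq (Uq ⊗[Cq] (uqPow m : Type))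

/-- The one-step unbraiding map `φ_{m+2}` on the `(m+2)`-nd braided tensor power. -/
def phi (m : ℕ) : (brPow (m + 1)).carrier →ₗ[Cq] Uq ⊗[Cq] (brPow m).carrier :=
  BrObj.unbraid (brPow m)

/-- The unbraiding map `γ_{m+1}`: `γ_1` is the inclusion and `γ_{n+1} = (id ⊗ γ_n) ∘ φ_{n+1}`. -/
def gamma : (m : ℕ) → (brPow m).carrier →ₗ[Cq] (uqPow m : Type)
  | 0 => Uq.lf.val.toLinearMap
  | m + 1 => (gamma m).lTensor Uq ∘ₗ phi m

end

namespace Uq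

/-! ### Scalars -/

/-- The scalar `q⁻²`. -/
noncomputable def pp : Cq := (qq ^ 2)⁻¹

/-- The scalar `(1 - q⁻²)(q - q⁻¹)`. -/
noncomputable def rr : Cq := (1 - pp) * (qq - qq⁻¹)

/-- The coefficient of `E^i ⊗ F^i` in the quasi-R-matrix. -/
noncomputable def cc (i : ℕ) : Cq := qq ^ (i * (i - 1) / 2) * (qq - qq⁻¹) ^ i / qFact i

theorem v_eq (i : ℕ) : v i = cc i • F ^ i := rfl

theorem pp_pow_eq_zpow (n : ℕ) : pp ^ n = qq ^ (2 * (-n : ℤ)) := by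
  rw [pp, inv_pow, ← pow_mul, mul_neg, zpow_neg]
  norm_cast

theorem pp_pow_ne_one (n : ℕ) : pp ^ (n + 1) ≠ 1 := by
  intro h
  rw [pp_pow_eq_zpow] at h
  have h0 : qq ^ (2 * (0 : ℤ)) = 1 := by simp
  have := qq_zpow_injective (h.trans h0.symm)
  push_cast at this
  omega

theorem one_sub_pp_pow_ne_zero (n : ℕ) : 1 - pp ^ (n + 1) ≠ 0 :=
  sub_ne_zero.2 (pp_pow_ne_one n).symm

theorem qq_sub_inv_ne_zero : qq - qq⁻¹ ≠ 0 := by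
  intro h
  have h1 := one_sub_pp_pow_ne_zero 0
  apply h1
  have hq := qq_ne_zero
  have h2 : qq = qq⁻¹ := sub_eq_zero.1 h
  rw [zero_add, pow_one, pp, pow_two, mul_inv, ← h2]
  nth_rewrite 1 [h2]
  rw [inv_mul_cancel₀ hq, sub_self]

theorem rr_ne_zero : rr ≠ 0 :=
  mul_ne_zero (by simpa using one_sub_pp_pow_ne_zero 0) qq_sub_inv_ne_zero

theorem qNum_mul (n : ℕ) : qNum (n + 1) * (qq - qq⁻¹) = qq ^ (n + 1) * (1 - pp ^ (n + 1)) := by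
  have hq := pow_ne_zero (n + 1) qq_ne_zero
  rw [qNum, div_mul_cancel₀ _ qq_sub_inv_ne_zero, pp, inv_pow, ← pow_mul, mul_comm 2, pow_mul,
    mul_sub, mul_one, pow_two, mul_inv, mul_inv_cancel_left₀ hq]

theorem qNum_ne_zero (n : ℕ) : qNum (n + 1) ≠ 0 := by
  intro h
  have := qNum_mul n
  rw [h, zero_mul] at this
  exact mul_ne_zero (pow_ne_zero _ qq_ne_zero) (one_sub_pp_pow_ne_zero n) this.symm

theorem qFact_ne_zero (n : ℕ) : qFact n ≠ 0 := by
  rw [qFact, Finset.prod_ne_zero_iff]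
  exact fun j _ => qNum_ne_zero j

@[simp] theorem cc_zero : cc 0 = 1 := by simp [cc, qFact]

theorem cc_succ (n : ℕ) : cc (n + 1) * (1 - pp ^ (n + 1)) = rr * cc n := by
  have hq := qq_ne_zero
  have h1 := qNum_ne_zero n
  have h2 := qFact_ne_zero n
  have h3 := qq_sub_inv_ne_zero
  have h4 : 1 - pp ^ (n + 1) = qNum (n + 1) * (qq - qq⁻¹) / qq ^ (n + 1) := by
    rw [qNum_mul, mul_div_cancel_left₀ _ (pow_ne_zero _ hq)]
  have h5 : 1 - pp = (qq - qq⁻¹) / qq := by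
    rw [pp]; field_simp
  rw [cc, cc, rr, h4, h5, Nat.triangle_succ, pow_add qq, qFact, Finset.prod_range_succ, ← qFact,
    pow_succ (qq - qq⁻¹), pow_succ qq n]
  generalize qq - qq⁻¹ = s at h3 ⊢
  field_simp

/-- The `q`-binomial theorem, for divided powers. -/
theorem cc_smul_add_pow {B : Type*} [Ring B] [Algebra Cq B] {P Q : B} (h : Q * P = pp • (P * Q))
    (n : ℕ) : cc n • (P + Q) ^ n =
      ∑ x ∈ Finset.HasAntidiagonal.antidiagonal n, (cc x.1 * cc x.2) • (P ^ x.1 * Q ^ x.2) := by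
  have hQ : ∀ j : ℕ, Q ^ j * P = pp ^ j • (P * Q ^ j) := by
    intro j
    induction j with
    | zero => simp
    | succ j ih =>
      rw [pow_succ', mul_assoc, ih, mul_smul_comm, ← mul_assoc, h, smul_mul_assoc, smul_smul,
        mul_assoc, ← pow_succ]
  induction n with
  | zero => simp
  | succ n ih =>
    have hn := one_sub_pp_pow_ne_zero n
    apply smul_right_injective B hn
    simp only
    rw [smul_smul, mul_comm, cc_succ, mul_smul, pow_succ, ← smul_mul_assoc, ih]
    have hsplit : ∀ x ∈ Finset.HasAntidiagonal.antidiagonal (n + 1),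
        (1 - pp ^ (n + 1)) • (cc x.1 * cc x.2) • (P ^ x.1 * Q ^ x.2) =
        (cc x.1 * (1 - pp ^ x.1) * cc x.2 * pp ^ x.2) • (P ^ x.1 * Q ^ x.2) +
        (cc x.1 * (cc x.2 * (1 - pp ^ x.2))) • (P ^ x.1 * Q ^ x.2) := by
      intro x hx
      rw [Finset.HasAntidiagonal.mem_antidiagonal] at hx
      rw [smul_smul, ← add_smul, ← hx, pow_add]
      congr 1
      ring
    rw [Finset.smul_sum, Finset.sum_congr rfl hsplit, Finset.sum_add_distrib,
      Finset.Nat.sum_antidiagonal_succ,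
      Finset.Nat.sum_antidiagonal_succ' (f := fun x : ℕ × ℕ =>
        (cc x.1 * (cc x.2 * (1 - pp ^ x.2))) • (P ^ x.1 * Q ^ x.2))]
    simp only [pow_zero, sub_self, mul_zero, zero_mul, zero_smul, zero_add, cc_succ]
    rw [← Finset.sum_add_distrib, Finset.sum_mul, Finset.smul_sum]
    refine Finset.sum_congr rfl fun x _ => ?_
    rw [smul_mul_assoc, mul_add, mul_assoc, hQ, mul_assoc, ← pow_succ, mul_smul_comm, ← mul_assoc,
      ← pow_succ, smul_add, smul_add, smul_smul, smul_smul, smul_smul]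
    congr 2 <;> ring

/-! ### Commutation with powers of `K` -/

/-- `x` has degree `d`: conjugation by `K` multiplies it by `q^{2d}`. -/
def HasDeg (d : ℤ) (x : Uq) : Prop := K * x = qq ^ (2 * d) • (x * K)

theorem HasDeg.mul {d e : ℤ} {x y : Uq} (hx : HasDeg d x) (hy : HasDeg e y) :
    HasDeg (d + e) (x * y) := by
  unfold HasDeg at *
  rw [← mul_assoc, hx, smul_mul_assoc, mul_assoc, hy, mul_smul_comm, smul_smul, mul_assoc,
    ← zpow_add₀ qq_ne_zero, mul_add]

theorem hasDeg_one : HasDeg 0 1 := by simp [HasDeg]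

theorem HasDeg.pow {d : ℤ} {x : Uq} (hx : HasDeg d x) (n : ℕ) : HasDeg (n * d) (x ^ n) := by
  induction n with
  | zero => simpa using hasDeg_one
  | succ n ih =>
    have := ih.mul hx
    rw [← pow_succ] at this
    convert this using 1
    push_cast
    ring

theorem HasDeg.smul {d : ℤ} {x : Uq} (hx : HasDeg d x) (c : Cq) : HasDeg d (c • x) := by
  unfold HasDeg at *
  rw [mul_smul_comm, hx, smul_mul_assoc, smul_comm]

theorem hasDeg_E : HasDeg 1 E := K_mul_E
theorem hasDeg_F : HasDeg (-1) F := K_mul_F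
theorem hasDeg_E_pow (n : ℕ) : HasDeg n (E ^ n) := by simpa using hasDeg_E.pow n
theorem hasDeg_F_pow (n : ℕ) : HasDeg (-n) (F ^ n) := by simpa using hasDeg_F.pow n
theorem hasDeg_v (n : ℕ) : HasDeg (-n) (v n) := (hasDeg_F_pow n).smul _

@[simp] theorem Kz_zero : Kz 0 = 1 := by simp [Kz]
@[simp] theorem Kz_one : Kz 1 = K := by simp [Kz, Kunit]
@[simp] theorem Kz_neg_one : Kz (-1) = Kinv := by simp [Kz, Kunit]
theorem Kz_add (m n : ℤ) : Kz (m + n) = Kz m * Kz n := by simp [Kz, zpow_add]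
theorem Kz_mul_Kz_neg (m : ℤ) : Kz m * Kz (-m) = 1 := by simp [← Kz_add]
theorem HasDeg.Kz_mul {d : ℤ} {x : Uq} (hx : HasDeg d x) (m : ℤ) :
    Kz m * x = qq ^ (2 * m * d) • (x * Kz m) := by
  have hq := qq_ne_zero
  induction m with
  | zero => simp
  | succ n ih =>
    rw [add_comm, Kz_add, mul_assoc, ih, mul_smul_comm, ← mul_assoc, Kz_one, hx, smul_mul_assoc,
      smul_smul, mul_assoc x, ← zpow_add₀ hq]
    congr 2
    ring
  | pred n ih =>
    have h1 : Kinv * x = qq ^ (-(2 * d)) • (x * Kinv) := by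
      have h : Kinv * (K * x) * Kinv = Kinv * (qq ^ (2 * d) • (x * K)) * Kinv := by rw [hx]
      rw [← mul_assoc, Kinv_mul_K, one_mul, mul_smul_comm, smul_mul_assoc, mul_assoc, mul_assoc,
        K_mul_Kinv, mul_one] at h
      rw [h, smul_smul, ← zpow_add₀ hq, neg_add_cancel, zpow_zero, one_smul]
    rw [sub_eq_add_neg, add_comm, Kz_add, mul_assoc, ih, mul_smul_comm, ← mul_assoc, Kz_neg_one, h1,
      smul_mul_assoc, smul_smul, mul_assoc x, ← zpow_add₀ hq]
    congr 2
    ring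

theorem HasDeg.mul_Kz {d : ℤ} {x : Uq} (hx : HasDeg d x) (m : ℤ) :
    x * Kz m = qq ^ (-(2 * m * d)) • (Kz m * x) := by
  rw [hx.Kz_mul, smul_smul, ← zpow_add₀ qq_ne_zero, neg_add_cancel, zpow_zero, one_smul]

theorem HasDeg.mul_K {d : ℤ} {x : Uq} (hx : HasDeg d x) :
    x * K = qq ^ (-(2 * d)) • (K * x) := by
  simpa using hx.mul_Kz 1

theorem HasDeg.mul_Kinv {d : ℤ} {x : Uq} (hx : HasDeg d x) :
    x * Kinv = qq ^ (2 * d) • (Kinv * x) := by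
  simpa using hx.mul_Kz (-1)

theorem HasDeg.Kinv_mul {d : ℤ} {x : Uq} (hx : HasDeg d x) :
    Kinv * x = qq ^ (-(2 * d)) • (x * Kinv) := by
  simpa using hx.Kz_mul (-1)

/-! ### Commutators with divided powers -/

theorem rr_smul_E_F : rr • (E * F - F * E) = (1 - pp) • (K - Kinv) := by
  rw [E_F, smul_smul, rr, mul_assoc, mul_inv_cancel₀ qq_sub_inv_ne_zero, mul_one]

theorem smul_sub_add_smul_sub {k V : Type*} [CommRing k] [AddCommGroup V] [Module k V] (s p : k)
    (a b : V) : (1 - s) • (p • a - b) + (1 - p) • (a - s • b) = (1 - s * p) • (a - b) := by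
  module

theorem E_mul_F_pow_sub (n : ℕ) : rr • (E * F ^ (n + 1) - F ^ (n + 1) * E) =
    (1 - pp ^ (n + 1)) • (F ^ n * K - Kinv * F ^ n) := by
  induction n with
  | zero => simp [rr_smul_E_F]
  | succ n ih =>
    have h1 : E * F ^ (n + 1 + 1) - F ^ (n + 1 + 1) * E =
        (E * F ^ (n + 1) - F ^ (n + 1) * E) * F + F ^ (n + 1) * (E * F - F * E) := by
      rw [pow_succ F (n + 1)]; noncomm_ring
    have h2 : F ^ (n + 1) * Kinv = pp ^ (n + 1) • (Kinv * F ^ (n + 1)) := by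
      rw [(hasDeg_F_pow (n + 1)).mul_Kinv, pp_pow_eq_zpow]
    rw [h1, smul_add, ← smul_mul_assoc, ih, ← mul_smul_comm, rr_smul_E_F, mul_smul_comm, mul_sub,
      smul_mul_assoc, sub_mul, mul_assoc, K_mul_F, mul_smul_comm, ← mul_assoc, ← pow_succ,
      mul_assoc, ← pow_succ, h2, ← pp, pow_succ pp (n + 1), smul_sub_add_smul_sub]

theorem E_pow_mul_F_sub (n : ℕ) : rr • (E ^ (n + 1) * F - F * E ^ (n + 1)) =
    (1 - pp ^ (n + 1)) • (K * E ^ n - E ^ n * Kinv) := by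
  induction n with
  | zero => simp [rr_smul_E_F]
  | succ n ih =>
    have h1 : E ^ (n + 1 + 1) * F - F * E ^ (n + 1 + 1) =
        E * (E ^ (n + 1) * F - F * E ^ (n + 1)) + (E * F - F * E) * E ^ (n + 1) := by
      rw [pow_succ' E (n + 1)]; noncomm_ring
    have h2 : Kinv * E ^ (n + 1) = pp ^ (n + 1) • (E ^ (n + 1) * Kinv) := by
      rw [(hasDeg_E_pow (n + 1)).Kinv_mul, pp_pow_eq_zpow, mul_neg]
    have h3 : E * K = pp • (K * E) := by
      rw [hasDeg_E.mul_K, ← pow_one pp, pp_pow_eq_zpow]; simp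
    rw [h1, smul_add, ← mul_smul_comm, ih, ← smul_mul_assoc, rr_smul_E_F, smul_mul_assoc, sub_mul,
      mul_smul_comm, mul_sub, ← mul_assoc E K, h3, smul_mul_assoc, mul_assoc K, ← mul_assoc E,
      ← pow_succ', h2, pow_succ pp (n + 1), smul_sub_add_smul_sub]

theorem E_mul_v_sub (n : ℕ) : E * v (n + 1) - v (n + 1) * E = v n * K - Kinv * v n := by
  apply smul_right_injective Uq rr_ne_zero
  simp only [v_eq]
  rw [mul_smul_comm, smul_mul_assoc, ← smul_sub, smul_comm, E_mul_F_pow_sub, smul_smul, cc_succ,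
    mul_smul_comm, smul_mul_assoc, ← smul_sub, mul_smul]

theorem cc_smul_E_pow_mul_F_sub (n : ℕ) : cc (n + 1) • (E ^ (n + 1) * F - F * E ^ (n + 1)) =
    cc n • (K * E ^ n - E ^ n * Kinv) := by
  apply smul_right_injective Uq rr_ne_zero
  simp only
  rw [smul_comm, E_pow_mul_F_sub, smul_smul, cc_succ, mul_smul]

/-! ### Comultiplication of divided powers -/

theorem comul_E : comul E = E ⊗ₜ K + 1 ⊗ₜ E := lift_E ..
theorem comul_F : comul F = F ⊗ₜ 1 + Kinv ⊗ₜ F := lift_F ..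
theorem comul_K : comul K = K ⊗ₜ K := lift_K ..
theorem comul_Kinv : comul Kinv = Kinv ⊗ₜ Kinv := lift_Kinv ..

theorem cc_smul_comul_E_pow (n : ℕ) : cc n • comul (E ^ n) =
    ∑ x ∈ Finset.HasAntidiagonal.antidiagonal n, (cc x.1 * cc x.2) • (E ^ x.1) ⊗ₜ[Cq] (K ^ x.1 * E ^ x.2) := by
  have h : ((1 : Uq) ⊗ₜ[Cq] E) * (E ⊗ₜ K) = pp • ((E ⊗ₜ K) * (1 ⊗ₜ E)) := by
    have h3 : E * K = pp • (K * E) := by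
      rw [hasDeg_E.mul_K, ← pow_one pp, pp_pow_eq_zpow]; simp
    rw [Algebra.TensorProduct.tmul_mul_tmul, Algebra.TensorProduct.tmul_mul_tmul, h3,
      TensorProduct.tmul_smul, one_mul, mul_one]
  rw [map_pow, comul_E, cc_smul_add_pow h]
  refine Finset.sum_congr rfl fun x _ => ?_
  rw [Algebra.TensorProduct.tmul_pow, Algebra.TensorProduct.tmul_pow,
    Algebra.TensorProduct.tmul_mul_tmul, one_pow, mul_one]

theorem cc_smul_comul_F_pow (n : ℕ) : cc n • comul (F ^ n) =
    ∑ x ∈ Finset.HasAntidiagonal.antidiagonal n,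
      (cc x.1 * cc x.2) • (Kinv ^ x.1 * F ^ x.2) ⊗ₜ[Cq] (F ^ x.1) := by
  have h : (F ⊗ₜ[Cq] (1 : Uq)) * (Kinv ⊗ₜ F) = pp • ((Kinv ⊗ₜ F) * (F ⊗ₜ 1)) := by
    have h3 : F * Kinv = pp • (Kinv * F) := by
      rw [hasDeg_F.mul_Kinv, ← pow_one pp, pp_pow_eq_zpow]; simp
    rw [Algebra.TensorProduct.tmul_mul_tmul, Algebra.TensorProduct.tmul_mul_tmul, h3,
      TensorProduct.smul_tmul', one_mul, mul_one]
  rw [map_pow, comul_F, add_comm, cc_smul_add_pow h]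
  refine Finset.sum_congr rfl fun x _ => ?_
  rw [Algebra.TensorProduct.tmul_pow, Algebra.TensorProduct.tmul_pow,
    Algebra.TensorProduct.tmul_mul_tmul, one_pow, mul_one]

/-- `h x = ∑ (h₍₁₎ ▷ x) h₍₂₎`. -/
theorem mul_eq_lift_comul (h x : Uq) :
    h * x = TensorProduct.lift ((LinearMap.mul Cq Uq) ∘ₗ ad.toLinearMap.flip x) (comul h) := by
  have hmul : ∀ g x : Uq, ∀ t : Uq ⊗[Cq] Uq,
      TensorProduct.lift ((LinearMap.mul Cq Uq) ∘ₗ ad.toLinearMap.flip x) (t * (1 ⊗ₜ g)) =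
        TensorProduct.lift ((LinearMap.mul Cq Uq) ∘ₗ ad.toLinearMap.flip x) t * g := by
    intro g x t
    induction t using TensorProduct.induction_on with
    | zero => simp
    | tmul a b => simp [mul_assoc]
    | add s t hs ht => rw [add_mul, map_add, hs, ht, map_add, add_mul]
  have hmul' : ∀ g x : Uq, ∀ t : Uq ⊗[Cq] Uq,
      TensorProduct.lift ((LinearMap.mul Cq Uq) ∘ₗ ad.toLinearMap.flip x) (t * (g ⊗ₜ 1)) =
        TensorProduct.lift ((LinearMap.mul Cq Uq) ∘ₗ ad.toLinearMap.flip (ad g x)) t := by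
    intro g x t
    induction t using TensorProduct.induction_on with
    | zero => simp
    | tmul a b => simp
    | add s t hs ht => rw [add_mul, map_add, hs, ht, map_add]
  have hgen : ∀ a g x : Uq, TensorProduct.lift ((LinearMap.mul Cq Uq) ∘ₗ ad.toLinearMap.flip x)
      (a ⊗ₜ[Cq] g) = ad a x * g := fun a g x => by simp
  induction h using Uq.induction generalizing x with
  | hc r =>
    rw [AlgHom.commutes, Algebra.algebraMap_eq_smul_one, Algebra.algebraMap_eq_smul_one, map_smul,
      Algebra.TensorProduct.one_def, hgen, map_one, Module.End.one_apply, mul_one, smul_mul_assoc,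
      one_mul]
  | hK => rw [comul_K, hgen, ad_K, mul_assoc, Kinv_mul_K, mul_one]
  | hKi => rw [comul_Kinv, hgen, ad_Kinv, mul_assoc, K_mul_Kinv, mul_one]
  | hE =>
    rw [comul_E, map_add, hgen, hgen, ad_E, map_one, Module.End.one_apply, sub_mul, mul_assoc,
      Kinv_mul_K, mul_one, mul_assoc, mul_assoc, Kinv_mul_K, mul_one, sub_add_cancel]
  | hF =>
    rw [comul_F, map_add, hgen, hgen, ad_F, ad_Kinv, mul_one, mul_assoc _ K F, sub_add_cancel]
  | hm a b ha hb =>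
    have key : ∀ t : Uq ⊗[Cq] Uq,
        a * TensorProduct.lift ((LinearMap.mul Cq Uq) ∘ₗ ad.toLinearMap.flip x) t =
        TensorProduct.lift ((LinearMap.mul Cq Uq) ∘ₗ ad.toLinearMap.flip x) (comul a * t) := by
      intro t
      induction t using TensorProduct.induction_on with
      | zero => simp
      | tmul c d =>
        have : c ⊗ₜ[Cq] d = (c ⊗ₜ 1) * (1 ⊗ₜ d) := by simp
        rw [hgen, ← mul_assoc, ha, this, ← mul_assoc, hmul, hmul']
      | add s t hs ht => rw [map_add, mul_add, hs, ht, mul_add, map_add]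
    rw [mul_assoc, hb, key, map_mul comul]
  | ha a b ha hb => rw [add_mul, ha, hb, map_add, map_add]

/-- `c_n F^n x = ∑ c_i c_j (K^{-i} F^j ▷ x) F^i`. -/
theorem cc_smul_F_pow_mul (n : ℕ) (x : Uq) : cc n • (F ^ n * x) =
    ∑ p ∈ Finset.HasAntidiagonal.antidiagonal n,
      (cc p.1 * cc p.2) • (ad (Kinv ^ p.1 * F ^ p.2) x * F ^ p.1) := by
  rw [mul_eq_lift_comul, ← map_smul, cc_smul_comul_F_pow, map_sum]
  refine Finset.sum_congr rfl fun p _ => ?_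
  rw [map_smul, TensorProduct.lift.tmul]
  rfl

end Uq

namespace BrObj

/-! ### Weight vectors -/

/-- `y` is a weight vector of degree `d`. -/
def IsWt (X : BrObj) (d : ℤ) (y : X.carrier) : Prop := X.act Uq.K y = qq ^ (2 * d) • y

/-- The projections of `X` are those of a grading by the weights of `K`. -/
structure Graded (X : BrObj) : Prop where
  span : ∀ x, x ∈ Submodule.span Cq {y | ∃ d, X.IsWt d y}
  proj_wt : ∀ d y, X.IsWt d y → ∀ e, X.proj e y = if e = d then y else 0

theorem Graded.of_homogeneous {X : BrObj} (h : ∀ x, x ∈ Submodule.span Cq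
    {y | ∃ d, X.IsWt d y ∧ ∀ e, X.proj e y = if e = d then y else 0}) : X.Graded where
  span x := Submodule.span_mono (by rintro _ ⟨d, hd⟩; exact ⟨d, hd.1⟩) (h x)
  proj_wt := by
    have hK : ∀ x e, X.proj e (X.act Uq.K x) = qq ^ (2 * e) • X.proj e x := by
      intro x e
      induction h x using Submodule.span_induction with
      | mem y hy =>
        obtain ⟨d, hd, hd'⟩ := hy
        rw [hd, map_smul, hd']
        split_ifs with he
        · rw [he]
        · simp
      | zero => simp
      | add y z _ _ h1 h2 => simp only [map_add, h1, h2, smul_add]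
      | smul c y _ h1 => simp only [map_smul, h1]; rw [smul_comm]
    have hs : ∀ x, ∑ᶠ e, X.proj e x = x := by
      intro x
      induction h x using Submodule.span_induction with
      | mem y hy =>
        obtain ⟨d, -, hd⟩ := hy
        simp only [hd]
        rw [finsum_eq_single _ d (fun n hn => if_neg hn), if_pos rfl]
      | zero => simp
      | add y z _ _ h1 h2 =>
        simp only [map_add]
        rw [finsum_add_distrib (X.proj_finite y) (X.proj_finite z), h1, h2]
      | smul c y _ h1 =>
        simp only [map_smul]
        rw [← smul_finsum' c (X.proj_finite y), h1]
    intro d y hy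
    have h0 : ∀ e, e ≠ d → X.proj e y = 0 := by
      intro e he
      have h1 := hK y e
      rw [hy, map_smul, ← sub_eq_zero, ← sub_smul, smul_eq_zero] at h1
      exact h1.resolve_left fun h2 => he (Uq.qq_zpow_injective (sub_eq_zero.1 h2)).symm
    intro e
    split_ifs with he
    · subst he
      rw [← finsum_eq_single _ e h0, hs]
    · exact h0 e he

variable {X Y : BrObj}

theorem IsWt.act {d e : ℤ} {y : X.carrier} (hy : X.IsWt d y) {h : Uq} (hh : Uq.HasDeg e h) :
    X.IsWt (e + d) (X.act h y) := by
  unfold IsWt at *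
  rw [← Module.End.mul_apply, ← map_mul, hh, map_smul, LinearMap.smul_apply, map_mul,
    Module.End.mul_apply, hy, map_smul, smul_smul, ← zpow_add₀ Uq.qq_ne_zero, mul_add]

theorem IsWt.act_K {d : ℤ} {y : X.carrier} (hy : X.IsWt d y) :
    X.act Uq.K y = qq ^ (2 * d) • y := hy

theorem IsWt.act_Kinv {d : ℤ} {y : X.carrier} (hy : X.IsWt d y) :
    X.act Uq.Kinv y = qq ^ (-(2 * d)) • y := by
  have h : X.act Uq.Kinv (X.act Uq.K y) = y := by
    rw [← Module.End.mul_apply, ← map_mul, Uq.Kinv_mul_K, map_one, Module.End.one_apply]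
  rw [hy, map_smul] at h
  nth_rewrite 2 [← h]
  rw [smul_smul, ← zpow_add₀ Uq.qq_ne_zero, neg_add_cancel, zpow_zero, one_smul]

theorem IsWt.act_K_pow {d : ℤ} {y : X.carrier} (hy : X.IsWt d y) (n : ℕ) :
    X.act (Uq.K ^ n) y = qq ^ (2 * n * d) • y := by
  induction n with
  | zero => simp
  | succ n ih =>
    rw [pow_succ, map_mul, Module.End.mul_apply, hy.act_K, map_smul, ih, smul_smul,
      ← zpow_add₀ Uq.qq_ne_zero]
    congr 2
    push_cast
    ring

theorem Graded.isWt_of_proj_eq (hX : X.Graded) {d : ℤ} {y : X.carrier} (hy : X.proj d y = y) :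
    X.IsWt d y := by
  have h : ∀ x, X.IsWt d (X.proj d x) := by
    intro x
    unfold IsWt
    induction hX.span x using Submodule.span_induction with
    | mem y hy =>
      obtain ⟨e, he⟩ := hy
      rw [hX.proj_wt e y he]
      split_ifs with h
      · rw [h]; exact he
      · simp
    | zero => simp
    | add y z _ _ h1 h2 => simp only [map_add, h1, h2, smul_add]
    | smul c y _ h1 => simp only [map_smul, h1]; rw [smul_comm]
  rw [← hy]
  exact h y

/-- A property of tensors closed under linear combinations holds always if it holds for `a ⊗ b`
with `b` a weight vector. -/
theorem Graded.tensor_induction (hY : Y.Graded) {M : Type} [AddCommGroup M] [Module Cq M]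
    {P : M ⊗[Cq] Y.carrier → Prop} (h0 : P 0) (hadd : ∀ s t, P s → P t → P (s + t))
    (hsmul : ∀ (c : Cq) t, P t → P (c • t))
    (hw : ∀ a d b, Y.IsWt d b → P (a ⊗ₜ b)) (t : M ⊗[Cq] Y.carrier) : P t := by
  induction t using TensorProduct.induction_on with
  | zero => exact h0
  | add s t hs ht => exact hadd s t hs ht
  | tmul a b =>
    induction hY.span b using Submodule.span_induction with
    | mem y hy => exact hw a hy.choose y hy.choose_spec
    | zero => rwa [TensorProduct.tmul_zero]
    | add y z _ _ h1 h2 => rw [TensorProduct.tmul_add]; exact hadd _ _ h1 h2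
    | smul c y _ h1 => rw [TensorProduct.tmul_smul]; exact hsmul _ _ h1

theorem Graded.tensor_ext (hY : Y.Graded) {M P : Type} [AddCommGroup M] [Module Cq M]
    [AddCommGroup P] [Module Cq P] {f g : M ⊗[Cq] Y.carrier →ₗ[Cq] P}
    (h : ∀ a d b, Y.IsWt d b → f (a ⊗ₜ b) = g (a ⊗ₜ b)) : f = g := by
  refine LinearMap.ext fun t => ?_
  induction t using hY.tensor_induction with
  | h0 => simp
  | hadd s t hs ht => rw [map_add, map_add, hs, ht]
  | hsmul c t ht => rw [map_smul, map_smul, ht]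
  | hw a d b hb => exact h a d b hb

theorem act_E_pow_comp (i j : ℕ) (x : X.carrier) :
    X.act (Uq.E ^ i) (X.act (Uq.E ^ j) x) = X.act (Uq.E ^ (i + j)) x := by
  rw [← Module.End.mul_apply, ← map_mul, pow_add]

/-! ### The action on a tensor product -/

theorem tensorAct_F (x : X.carrier) (y : Y.carrier) : tensorAct X Y Uq.F (x ⊗ₜ y) =
    X.act Uq.F x ⊗ₜ y + X.act Uq.Kinv x ⊗ₜ Y.act Uq.F y := by
  unfold tensorAct
  rw [AlgHom.comp_apply, AlgHom.comp_apply, Uq.comul_F]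
  simp [Module.endTensorEndAlgHom_apply]

theorem tensorAct_K (x : X.carrier) (y : Y.carrier) :
    tensorAct X Y Uq.K (x ⊗ₜ y) = X.act Uq.K x ⊗ₜ Y.act Uq.K y := by
  unfold tensorAct
  rw [AlgHom.comp_apply, AlgHom.comp_apply, Uq.comul_K]
  simp [Module.endTensorEndAlgHom_apply]

theorem tensorAct_Kinv (x : X.carrier) (y : Y.carrier) :
    tensorAct X Y Uq.Kinv (x ⊗ₜ y) = X.act Uq.Kinv x ⊗ₜ Y.act Uq.Kinv y := by
  unfold tensorAct
  rw [AlgHom.comp_apply, AlgHom.comp_apply, Uq.comul_Kinv]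
  simp [Module.endTensorEndAlgHom_apply]

theorem tensorProj_tmul (hX : X.Graded) (hY : Y.Graded) {d e : ℤ} {x : X.carrier} {y : Y.carrier}
    (hx : X.IsWt d x) (hy : Y.IsWt e y) (f : ℤ) :
    tensorProj X Y f (x ⊗ₜ y) = if f = d + e then x ⊗ₜ y else 0 := by
  change ∑ᶠ c : ℤ, TensorProduct.map (X.proj c) (Y.proj (f - c)) (x ⊗ₜ y) = _
  simp only [TensorProduct.map_tmul, hX.proj_wt d x hx, hY.proj_wt e y hy]
  rw [finsum_eq_single _ d (fun c hc => by rw [if_neg hc, TensorProduct.zero_tmul]), if_pos rfl]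
  by_cases h : f = d + e
  · rw [if_pos h, if_pos (by omega)]
  · rw [if_neg h, if_neg (by omega), TensorProduct.tmul_zero]

theorem Graded.tensor (hX : X.Graded) (hY : Y.Graded) : (tensor X Y).Graded := by
  refine Graded.of_homogeneous fun t => ?_
  change t ∈ Submodule.span Cq {s : X.carrier ⊗[Cq] Y.carrier | ∃ d,
    tensorAct X Y Uq.K s = qq ^ (2 * d) • s ∧ ∀ e, tensorProj X Y e s = if e = d then s else 0}
  induction t using hY.tensor_induction with
  | h0 => exact Submodule.zero_mem _
  | hadd s t hs ht => exact Submodule.add_mem _ hs ht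
  | hsmul c t ht => exact Submodule.smul_mem _ _ ht
  | hw a e b hb =>
    induction hX.span a using Submodule.span_induction with
    | mem a ha =>
      obtain ⟨d, ha⟩ := ha
      refine Submodule.subset_span ⟨d + e, ?_, fun f => tensorProj_tmul hX hY ha hb f⟩
      rw [tensorAct_K, ha.act_K, hb.act_K, TensorProduct.tmul_smul, ← TensorProduct.smul_tmul',
        smul_smul, ← zpow_add₀ Uq.qq_ne_zero]
      congr 2
      ring
    | zero => rw [TensorProduct.zero_tmul]; exact Submodule.zero_mem _
    | add y z _ _ h1 h2 => rw [TensorProduct.add_tmul]; exact Submodule.add_mem _ h1 h2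
    | smul c y _ h1 => rw [← TensorProduct.smul_tmul']; exact Submodule.smul_mem _ _ h1

/-! ### Module algebras -/

/-- A graded associative unital algebra on which `U_q(sl₂)` acts as on a module algebra. -/
structure IsModuleAlgebra (X : BrObj) : Prop where
  graded : X.Graded
  mul_assoc : ∀ x y z, X.mul (X.mul x y) z = X.mul x (X.mul y z)
  one_mul : ∀ x, X.mul X.one x = x
  mul_one : ∀ x, X.mul x X.one = x
  act_K_mul : ∀ x y, X.act Uq.K (X.mul x y) = X.mul (X.act Uq.K x) (X.act Uq.K y)
  act_Kinv_mul : ∀ x y, X.act Uq.Kinv (X.mul x y) = X.mul (X.act Uq.Kinv x) (X.act Uq.Kinv y)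
  act_E_mul : ∀ x y, X.act Uq.E (X.mul x y) =
    X.mul (X.act Uq.E x) (X.act Uq.K y) + X.mul x (X.act Uq.E y)
  act_F_mul : ∀ x y, X.act Uq.F (X.mul x y) =
    X.mul (X.act Uq.F x) y + X.mul (X.act Uq.Kinv x) (X.act Uq.F y)
  act_K_one : X.act Uq.K X.one = X.one
  act_E_one : X.act Uq.E X.one = 0

theorem IsModuleAlgebra.act_lift_mul (hX : X.IsModuleAlgebra) (h : Uq)
    (t : X.carrier ⊗[Cq] X.carrier) :
    X.act h (TensorProduct.lift X.mul t) = TensorProduct.lift X.mul (tensorAct X X h t) := by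
  induction h using Uq.induction generalizing t with
  | hc r => simp
  | hm a b ha hb => rw [map_mul, map_mul, Module.End.mul_apply, hb, ha, Module.End.mul_apply]
  | ha a b ha hb => simp only [map_add, LinearMap.add_apply, ha, hb]
  | hK =>
    induction t using TensorProduct.induction_on with
    | zero => simp
    | tmul x y => simp [tensorAct_K, hX.act_K_mul]
    | add s t hs ht => simp only [map_add, hs, ht]
  | hKi =>
    induction t using TensorProduct.induction_on with
    | zero => simp
    | tmul x y => simp [tensorAct_Kinv, hX.act_Kinv_mul]
    | add s t hs ht => simp only [map_add, hs, ht]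
  | hE =>
    induction t using TensorProduct.induction_on with
    | zero => simp
    | tmul x y => simp [tensorAct_E, hX.act_E_mul]
    | add s t hs ht => simp only [map_add, hs, ht]
  | hF =>
    induction t using TensorProduct.induction_on with
    | zero => simp
    | tmul x y => simp [tensorAct_F, hX.act_F_mul]
    | add s t hs ht => simp only [map_add, hs, ht]

theorem IsModuleAlgebra.cc_smul_act_E_pow_mul (hX : X.IsModuleAlgebra) (n : ℕ) (x y : X.carrier) :
    Uq.cc n • X.act (Uq.E ^ n) (X.mul x y) = ∑ p ∈ Finset.HasAntidiagonal.antidiagonal n,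
      (Uq.cc p.1 * Uq.cc p.2) •
        X.mul (X.act (Uq.E ^ p.1) x) (X.act (Uq.K ^ p.1) (X.act (Uq.E ^ p.2) y)) := by
  have h := hX.act_lift_mul (Uq.E ^ n) (x ⊗ₜ y)
  rw [TensorProduct.lift.tmul] at h
  rw [h, ← map_smul, ← LinearMap.smul_apply]
  unfold tensorAct
  rw [AlgHom.comp_apply, AlgHom.comp_apply, ← map_smul, ← map_smul, Uq.cc_smul_comul_E_pow,
    map_sum, map_sum, LinearMap.sum_apply, map_sum]
  refine Finset.sum_congr rfl fun p _ => ?_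
  rw [map_smul, map_smul, LinearMap.smul_apply, map_smul, Algebra.TensorProduct.map_tmul,
    Module.endTensorEndAlgHom_apply, TensorProduct.AlgebraTensorModule.map_tmul,
    TensorProduct.lift.tmul, map_mul X.act, Module.End.mul_apply]

theorem IsWt.mul (hX : X.IsModuleAlgebra) {d e : ℤ} {x y : X.carrier} (hx : X.IsWt d x)
    (hy : X.IsWt e y) : X.IsWt (d + e) (X.mul x y) := by
  unfold IsWt
  rw [hX.act_K_mul, hx.act_K, hy.act_K, map_smul, map_smul, LinearMap.smul_apply, smul_smul,
    ← zpow_add₀ Uq.qq_ne_zero]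
  congr 2
  ring

theorem IsModuleAlgebra.isWt_one (hX : X.IsModuleAlgebra) : X.IsWt 0 X.one := by
  unfold IsWt
  simp [hX.act_K_one]

/-! ### The locally finite part -/

theorem _root_.Uq.proj_proj (x : Uq) (d e : ℤ) :
    Uq.proj e (Uq.proj d x) = if e = d then Uq.proj d x else 0 := by
  induction Uq.mem_span_homogeneous x using Submodule.span_induction with
  | mem y hy =>
    obtain ⟨c, hc, -⟩ := hy
    rw [Uq.proj_of_homogeneous hc d]
    split_ifs with h h' h'
    · rw [Uq.proj_of_homogeneous hc, if_pos (h'.trans h)]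
    · rw [Uq.proj_of_homogeneous hc, if_neg (h ▸ h')]
    · exact map_zero _
    · exact map_zero _
  | zero => simp
  | add y z _ _ h1 h2 => rw [map_add, map_add, h1, h2]; split_ifs <;> simp
  | smul c y _ h1 => rw [map_smul, map_smul, h1]; split_ifs <;> simp

theorem lf_graded : lf.Graded := by
  refine Graded.of_homogeneous fun (x : Uq.lf) => ?_
  have hx : x = ∑ d ∈ (Uq.lfProj_finite x).toFinset, Uq.lfProj d x := by
    apply Subtype.ext
    rw [← Uq.finsum_proj (x : Uq), finsum_eq_sum_of_support_subset (s :=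
      (Uq.lfProj_finite x).toFinset), AddSubmonoidClass.coe_finsetSum]
    · rfl
    · intro d hd
      simp only [Set.Finite.coe_toFinset]
      exact fun h => hd (congrArg Subtype.val h)
  rw [hx]
  refine Submodule.sum_mem _ fun d _ => Submodule.subset_span ⟨d, ?_, fun e => ?_⟩
  · exact Subtype.ext (Uq.ad_K_proj (x : Uq) d)
  · have h1 : Uq.lfProj e (Uq.lfProj d x) = if e = d then Uq.lfProj d x else 0 := by
      split_ifs with h
      · exact Subtype.ext ((Uq.proj_proj (x : Uq) d e).trans (if_pos h))
      · exact Subtype.ext ((Uq.proj_proj (x : Uq) d e).trans (if_neg h))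
    exact h1

theorem lf_isModuleAlgebra : lf.IsModuleAlgebra where
  graded := lf_graded
  mul_assoc := fun (x y z : Uq.lf) => _root_.mul_assoc x y z
  one_mul := fun (x : Uq.lf) => _root_.one_mul x
  mul_one := fun (x : Uq.lf) => _root_.mul_one x
  act_K_mul := fun (x y : Uq.lf) => Subtype.ext (Uq.ad_K_mul (x : Uq) y)
  act_Kinv_mul := fun (x y : Uq.lf) => Subtype.ext (Uq.ad_Kinv_mul (x : Uq) y)
  act_E_mul := fun (x y : Uq.lf) => Subtype.ext (Uq.ad_E_mul (x : Uq) y)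
  act_F_mul := fun (x y : Uq.lf) => Subtype.ext (Uq.ad_F_mul (x : Uq) y)
  act_K_one := Subtype.ext (by
    change Uq.ad Uq.K 1 = 1
    rw [Uq.ad_K, _root_.mul_one, Uq.K_mul_Kinv])
  act_E_one := Subtype.ext (by
    change Uq.ad Uq.E 1 = 0
    rw [Uq.ad_E, _root_.mul_one, _root_.one_mul, sub_self])

end BrObj

/-- A double sum over antidiagonals, when only a rectangle contributes. -/
theorem Finset.sum_range_sum_antidiagonal {M : Type*} [AddCommMonoid M] (f : ℕ → ℕ → M)
    (A B N : ℕ) (h : ∀ i j, f i j ≠ 0 → i < A ∧ j < B ∧ i + j < N) :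
    ∑ n ∈ Finset.range N, ∑ p ∈ Finset.HasAntidiagonal.antidiagonal n, f p.1 p.2 =
      ∑ i ∈ Finset.range A, ∑ j ∈ Finset.range B, f i j := by
  classical
  let s : Finset (ℕ × ℕ) := (Finset.range A ×ˢ Finset.range B).filter fun p => p.1 + p.2 < N
  have h1 : ∑ p ∈ s, f p.1 p.2 = ∑ i ∈ Finset.range A, ∑ j ∈ Finset.range B, f i j := by
    rw [← Finset.sum_product' (f := f)]
    refine Finset.sum_subset (Finset.filter_subset _ _) fun p hp hps => ?_
    by_contra h0
    exact hps (Finset.mem_filter.2 ⟨hp, (h _ _ h0).2.2⟩)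
  rw [← h1, ← Finset.sum_fiberwise_of_maps_to (s := s) (t := Finset.range N)
    (g := fun p => p.1 + p.2) (fun p hp => Finset.mem_range.2 (Finset.mem_filter.1 hp).2)
    (fun p => f p.1 p.2)]
  refine Finset.sum_congr rfl fun n _ => (Finset.sum_subset (fun p hp => ?_) fun p hp hps => ?_).symm
  · exact Finset.HasAntidiagonal.mem_antidiagonal.2 (Finset.mem_filter.1 hp).2
  · by_contra h0
    obtain ⟨ha, hb, hc⟩ := h _ _ h0
    exact hps (Finset.mem_filter.2 ⟨Finset.mem_filter.2 ⟨Finset.mem_product.2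
      ⟨Finset.mem_range.2 ha, Finset.mem_range.2 hb⟩, hc⟩,
      Finset.HasAntidiagonal.mem_antidiagonal.1 hp⟩)

namespace BrObj

variable {X Y : BrObj}

/-! ### The unbraiding map -/

theorem Graded.unbraidAux_apply (hY : Y.Graded) {d : ℤ} {b : Y.carrier} (hb : Y.IsWt d b) {N : ℕ}
    (hN : ∀ i ≥ N, Y.act (Uq.E ^ i) b = 0) : unbraidAux Y b =
      ∑ i ∈ Finset.range N, (Uq.Kz (i + d) * Uq.v i) ⊗ₜ[Cq] Y.act (Uq.E ^ i) b := by
  change ∑ᶠ p : ℕ × ℤ, (Uq.Kz (p.1 + p.2) * Uq.v p.1) ⊗ₜ[Cq]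
    Y.act (Uq.E ^ p.1) (Y.proj p.2 b) = _
  rw [finsum_eq_sum_of_support_subset (s := Finset.range N ×ˢ {d})]
  · rw [Finset.sum_product]
    refine Finset.sum_congr rfl fun i _ => ?_
    rw [Finset.sum_singleton, hY.proj_wt d b hb, if_pos rfl]
  · rintro ⟨i, e⟩ hi
    rw [Function.mem_support, hY.proj_wt d b hb] at hi
    simp only [Finset.coe_product, Set.mem_prod, Finset.coe_range, Set.mem_Iio,
      Finset.coe_singleton, Set.mem_singleton_iff]
    by_contra h
    apply hi
    by_cases he : e = d
    · rw [if_pos he, hN i (by omega), TensorProduct.tmul_zero]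
    · rw [if_neg he, map_zero, TensorProduct.tmul_zero]

/-- The map `a ⊗ y ↦ ∑_i a K^{i+|y|} v_i ⊗ (u_i ▷ y)` on the whole of `U_q(sl₂) ⊗ Y`. -/
noncomputable def unbraidU (Y : BrObj) : Uq ⊗[Cq] Y.carrier →ₗ[Cq] Uq ⊗[Cq] Y.carrier :=
  TensorProduct.lift ((LinearMap.lcomp Cq (Uq ⊗[Cq] Y.carrier) (unbraidAux Y)) ∘ₗ
    (LinearMap.rTensorHom Y.carrier) ∘ₗ (LinearMap.mul Cq Uq))

theorem Graded.unbraidU_tmul (hY : Y.Graded) (a : Uq) {d : ℤ} {b : Y.carrier} (hb : Y.IsWt d b)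
    {N : ℕ} (hN : ∀ i ≥ N, Y.act (Uq.E ^ i) b = 0) : unbraidU Y (a ⊗ₜ b) =
      ∑ i ∈ Finset.range N, (a * (Uq.Kz (i + d) * Uq.v i)) ⊗ₜ[Cq] Y.act (Uq.E ^ i) b := by
  change (LinearMap.mul Cq Uq a).rTensor Y.carrier (unbraidAux Y b) = _
  rw [hY.unbraidAux_apply hb hN, map_sum]
  rfl

/-! ### The braided product -/

theorem braiding_tmul (hX : X.Graded) (hY : Y.Graded) {d e : ℤ} {x : X.carrier} {y : Y.carrier}
    (hx : X.IsWt d x) (hy : Y.IsWt e y) {N : ℕ} (hN : ∀ i ≥ N, X.act (Uq.E ^ i) x = 0) :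
    braiding X Y (x ⊗ₜ y) = ∑ i ∈ Finset.range N,
      qq ^ (2 * (d + i) * (e - i)) • (Y.act (Uq.v i) y ⊗ₜ[Cq] X.act (Uq.E ^ i) x) := by
  change ∑ᶠ p : ℕ × ℤ × ℤ, qq ^ (2 * (p.2.1 + p.1) * (p.2.2 - p.1)) •
    (Y.act (Uq.v p.1) (Y.proj p.2.2 y) ⊗ₜ[Cq] X.act (Uq.E ^ p.1) (X.proj p.2.1 x)) = _
  rw [finsum_eq_sum_of_support_subset (s := Finset.range N ×ˢ {(d, e)})]
  · rw [Finset.sum_product]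
    refine Finset.sum_congr rfl fun i _ => ?_
    rw [Finset.sum_singleton, hX.proj_wt d x hx, hY.proj_wt e y hy, if_pos rfl, if_pos rfl]
  · rintro ⟨i, d', e'⟩ hi
    rw [Function.mem_support, hX.proj_wt d x hx, hY.proj_wt e y hy] at hi
    simp only [Finset.coe_product, Set.mem_prod, Finset.coe_range, Set.mem_Iio,
      Finset.coe_singleton, Set.mem_singleton_iff, Prod.mk.injEq]
    by_contra h
    apply hi
    by_cases hd : d' = d
    · by_cases he : e' = e
      · rw [if_pos hd, hN i (by omega), TensorProduct.tmul_zero, smul_zero]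
      · rw [if_neg he, map_zero, TensorProduct.zero_tmul, smul_zero]
    · rw [if_neg hd, map_zero, TensorProduct.tmul_zero, smul_zero]

theorem braidedMul_tmul (hX : X.Graded) (hY : Y.Graded) {d e : ℤ} (g : X.carrier) {h : Y.carrier}
    {x : X.carrier} (y : Y.carrier) (hh : Y.IsWt d h) (hx : X.IsWt e x) {N : ℕ}
    (hN : ∀ i ≥ N, Y.act (Uq.E ^ i) h = 0) :
    braidedMul X Y (g ⊗ₜ h) (x ⊗ₜ y) = ∑ i ∈ Finset.range N, qq ^ (2 * (d + i) * (e - i)) •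
      (X.mul g (X.act (Uq.v i) x) ⊗ₜ[Cq] Y.mul (Y.act (Uq.E ^ i) h) y) := by
  simp only [braidedMul, TensorProduct.curry_apply, LinearMap.comp_apply, LinearEquiv.coe_coe,
    TensorProduct.assoc_tmul, LinearMap.lTensor_tmul, TensorProduct.assoc_symm_tmul,
    LinearMap.rTensor_tmul, braiding_tmul hY hX hh hx hN, TensorProduct.sum_tmul, map_sum,
    TensorProduct.tmul_sum]
  refine Finset.sum_congr rfl fun i _ => ?_
  rw [← TensorProduct.smul_tmul', map_smul, TensorProduct.tmul_smul, map_smul, map_smul]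
  rfl

end BrObj

namespace Uq

theorem cc_ne_zero (n : ℕ) : cc n ≠ 0 :=
  div_ne_zero (mul_ne_zero (pow_ne_zero _ qq_ne_zero) (pow_ne_zero _ qq_sub_inv_ne_zero))
    (qFact_ne_zero n)

theorem hasDeg_iff_ad_K {d : ℤ} {x : Uq} : HasDeg d x ↔ ad K x = qq ^ (2 * d) • x := by
  rw [ad_K]
  unfold HasDeg
  constructor <;> intro h
  · rw [h, smul_mul_assoc, mul_assoc, K_mul_Kinv, mul_one]
  · rw [← smul_mul_assoc, ← h, mul_assoc, Kinv_mul_K, mul_one]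

theorem HasDeg.ad {d e : ℤ} {h x : Uq} (hh : HasDeg d h) (hx : HasDeg e x) :
    HasDeg (d + e) (ad h x) := by
  rw [hasDeg_iff_ad_K] at hx ⊢
  rw [← Module.End.mul_apply, ← map_mul, hh, map_smul, LinearMap.smul_apply, map_mul,
    Module.End.mul_apply, hx, map_smul, smul_smul, ← zpow_add₀ qq_ne_zero, mul_add]

theorem HasDeg.ad_Kinv_pow {d : ℤ} {x : Uq} (hx : HasDeg d x) (n : ℕ) :
    Uq.ad (Kinv ^ n) x = qq ^ (-(2 * n * d)) • x := by
  have h : Uq.ad Kinv x = qq ^ (-(2 * d)) • x := by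
    rw [ad_Kinv, hx.Kinv_mul, smul_mul_assoc, mul_assoc, Kinv_mul_K, mul_one]
  induction n with
  | zero => simp
  | succ n ih =>
    rw [pow_succ, map_mul, Module.End.mul_apply, h, map_smul, ih, smul_smul,
      ← zpow_add₀ qq_ne_zero]
    congr 2
    push_cast
    ring

theorem Kz_mul_v_mul_Kz_mul_v {e : ℤ} {x : Uq} (hx : HasDeg e x) (d f : ℤ) (m k : ℕ) :
    Kz (m + d) * v m * (x * (Kz (k + f) * v k)) =
      ∑ p ∈ Finset.HasAntidiagonal.antidiagonal m,
        (cc p.2 * qq ^ (2 * (d + p.2) * (e - p.2)) * (cc p.1 * cc k * qq ^ (2 * p.1 * (k + f)))) •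
          (ad (F ^ p.2) x * (Kz (p.1 + k + (p.2 + d + f)) * F ^ (p.1 + k))) := by
  have h1 : Kz (m + d) * v m * (x * (Kz (k + f) * v k)) =
      Kz (m + d) * (cc m • (F ^ m * x)) * (Kz (k + f) * v k) := by
    rw [v_eq m]
    simp only [mul_assoc, smul_mul_assoc, mul_smul_comm]
  rw [h1, cc_smul_F_pow_mul, Finset.mul_sum, Finset.sum_mul]
  refine Finset.sum_congr rfl fun p hp => ?_
  rw [Finset.HasAntidiagonal.mem_antidiagonal] at hp
  obtain ⟨j, i⟩ := p
  simp only at hp ⊢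
  have hy := (hasDeg_F_pow i).ad hx
  rw [map_mul, Module.End.mul_apply, hy.ad_Kinv_pow]
  generalize ad (F ^ i) x = y at hy ⊢
  have h2 : Kz (m + d) * (y * F ^ j) * (Kz (k + f) * v k) =
      cc k • ((Kz (m + d) * y) * (F ^ j * Kz (k + f)) * F ^ k) := by
    rw [v_eq k]
    simp only [mul_assoc, mul_smul_comm]
  have h3 : y * Kz (m + d) * (Kz (k + f) * F ^ j) * F ^ k =
      y * (Kz (j + k + (i + d + f)) * F ^ (j + k)) := by
    have : (j : ℤ) + k + (i + d + f) = (m + d) + (k + f) := by rw [← hp]; push_cast; ring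
    rw [this, Kz_add (m + d), pow_add]
    simp only [mul_assoc]
  rw [smul_mul_assoc, smul_smul, mul_smul_comm, smul_mul_assoc, h2, hy.Kz_mul,
    (hasDeg_F_pow j).mul_Kz, smul_mul_assoc, mul_smul_comm, smul_mul_assoc, smul_mul_assoc, h3,
    smul_smul, smul_smul, smul_smul]
  congr 1
  have hq : qq ^ (2 * (d + i) * (e - i)) * qq ^ (2 * j * (k + f)) =
      qq ^ (-(2 * j * (-i + e))) * qq ^ (2 * (m + d) * (-i + e)) *
        qq ^ (-(2 * (k + f) * -(j : ℤ))) := by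
    rw [← zpow_add₀ qq_ne_zero, ← zpow_add₀ qq_ne_zero, ← zpow_add₀ qq_ne_zero, ← hp]
    congr 1
    push_cast
    ring
  linear_combination -(cc i * cc j * cc k) * hq

end Uq

namespace BrObj

variable {Y : BrObj}

/-! ### Multiplicativity of the unbraiding map -/

theorem IsModuleAlgebra.unbraidU_mul_tmul (hY : Y.IsModuleAlgebra) (a : Uq) {d f : ℤ}
    {h y : Y.carrier} (hh : Y.IsWt d h) (hy : Y.IsWt f y) {N : ℕ}
    (hN : ∀ i ≥ N, Y.act (Uq.E ^ i) h = 0) (hN' : ∀ i ≥ N, Y.act (Uq.E ^ i) y = 0) :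
    unbraidU Y (a ⊗ₜ Y.mul h y) = ∑ j ∈ Finset.range N, ∑ k ∈ Finset.range N,
      (Uq.cc j * Uq.cc k * qq ^ (2 * j * (k + f))) •
        (a * (Uq.Kz (j + k + (d + f)) * Uq.F ^ (j + k))) ⊗ₜ[Cq]
          Y.mul (Y.act (Uq.E ^ j) h) (Y.act (Uq.E ^ k) y) := by
  have hv : ∀ n ≥ N + N, Y.act (Uq.E ^ n) (Y.mul h y) = 0 := by
    intro n hn
    apply smul_right_injective _ (Uq.cc_ne_zero n)
    simp only
    rw [hY.cc_smul_act_E_pow_mul, smul_zero]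
    refine Finset.sum_eq_zero fun p hp => ?_
    rw [Finset.HasAntidiagonal.mem_antidiagonal] at hp
    by_cases h1 : N ≤ p.1
    · rw [hN _ h1, map_zero, LinearMap.zero_apply, smul_zero]
    · rw [hN' p.2 (by omega), map_zero, map_zero, smul_zero]
  rw [hY.graded.unbraidU_tmul a (hh.mul hY hy) hv,
    ← Finset.sum_range_sum_antidiagonal _ N N (N + N)]
  · refine Finset.sum_congr rfl fun n _ => ?_
    rw [Uq.v_eq, mul_smul_comm, mul_smul_comm, TensorProduct.smul_tmul, hY.cc_smul_act_E_pow_mul,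
      TensorProduct.tmul_sum]
    refine Finset.sum_congr rfl fun p hp => ?_
    rw [Finset.HasAntidiagonal.mem_antidiagonal] at hp
    rw [(hy.act (Uq.hasDeg_E_pow p.2)).act_K_pow, map_smul, smul_smul, TensorProduct.tmul_smul, hp,
      ← hp]
    push_cast
    rfl
  · intro j k hjk
    have h1 : j < N := by
      by_contra h1
      exact hjk (by rw [hN j (by omega), map_zero, LinearMap.zero_apply, TensorProduct.tmul_zero,
        smul_zero])
    have h2 : k < N := by
      by_contra h2
      exact hjk (by rw [hN' k (by omega), map_zero, TensorProduct.tmul_zero, smul_zero])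
    exact ⟨h1, h2, by omega⟩

/-- The inclusion of the locally finite part. -/
noncomputable def lfVal : lf.carrier →ₗ[Cq] Uq := Uq.lf.val.toLinearMap

theorem lfVal_mul (x y : lf.carrier) : lfVal (lf.mul x y) = lfVal x * lfVal y := rfl
theorem lfVal_act (h : Uq) (x : lf.carrier) : lfVal (lf.act h x) = Uq.ad h (lfVal x) := rfl
theorem lfVal_one : lfVal lf.one = 1 := rfl
theorem lfVal_injective : Function.Injective lfVal := Subtype.val_injective

theorem IsWt.hasDeg_lfVal {d : ℤ} {x : lf.carrier} (hx : lf.IsWt d x) :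
    Uq.HasDeg d (lfVal x) := by
  rw [Uq.hasDeg_iff_ad_K, ← lfVal_act, hx.act_K, map_smul]

/-- The unbraiding map, as a restriction of `unbraidU`. -/
noncomputable def unbraidLf (Y : BrObj) : lf.carrier ⊗[Cq] Y.carrier →ₗ[Cq] Uq ⊗[Cq] Y.carrier :=
  unbraidU Y ∘ₗ lfVal.rTensor Y.carrier

theorem unbraidLf_tmul (a : lf.carrier) (b : Y.carrier) :
    unbraidLf Y (a ⊗ₜ b) = unbraidU Y (lfVal a ⊗ₜ b) := rfl

theorem unbraid_eq_unbraidLf : unbraid Y = unbraidLf Y :=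
  TensorProduct.ext' fun _ _ => rfl

theorem ordMul_tmul (a b : Uq) (s t : Y.carrier) :
    ordMul Y (a ⊗ₜ s) (b ⊗ₜ t) = (a * b) ⊗ₜ Y.mul s t := rfl

theorem IsModuleAlgebra.unbraidLf_mul_tmul (hY : Y.IsModuleAlgebra) (g x : lf.carrier) {d e f : ℤ}
    {h y : Y.carrier} (hx : lf.IsWt e x) (hh : Y.IsWt d h) (hy : Y.IsWt f y) :
    unbraidLf Y (braidedMul lf Y (g ⊗ₜ h) (x ⊗ₜ y)) =
      ordMul Y (unbraidLf Y (g ⊗ₜ h)) (unbraidLf Y (x ⊗ₜ y)) := by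
  obtain ⟨N₁, hN₁⟩ := Y.E_nilpotent h
  obtain ⟨N₂, hN₂⟩ := Y.E_nilpotent y
  have hN : ∀ i ≥ max N₁ N₂, Y.act (Uq.E ^ i) h = 0 := fun i hi => hN₁ i (le_of_max_le_left hi)
  have hN' : ∀ i ≥ max N₁ N₂, Y.act (Uq.E ^ i) y = 0 := fun i hi => hN₂ i (le_of_max_le_right hi)
  generalize max N₁ N₂ = N at hN hN'
  let T : ℕ → ℕ → ℕ → Uq ⊗[Cq] Y.carrier := fun i j k =>
    (Uq.cc i * qq ^ (2 * (d + i) * (e - i)) * (Uq.cc j * Uq.cc k * qq ^ (2 * j * (k + f)))) •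
      (lfVal g * (Uq.ad (Uq.F ^ i) (lfVal x) *
        (Uq.Kz (j + k + (i + d + f)) * Uq.F ^ (j + k)))) ⊗ₜ[Cq]
        Y.mul (Y.act (Uq.E ^ (j + i)) h) (Y.act (Uq.E ^ k) y)
  have hl : unbraidLf Y (braidedMul lf Y (g ⊗ₜ h) (x ⊗ₜ y)) =
      ∑ i ∈ Finset.range N, ∑ j ∈ Finset.range N, ∑ k ∈ Finset.range N, T i j k := by
    rw [braidedMul_tmul lf_graded hY.graded g y hh hx hN, map_sum]
    refine Finset.sum_congr rfl fun i _ => ?_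
    have hN'' : ∀ j ≥ N, Y.act (Uq.E ^ j) (Y.act (Uq.E ^ i) h) = 0 := fun j hj => by
      rw [act_E_pow_comp, hN _ (by omega)]
    rw [map_smul, unbraidLf_tmul, lfVal_mul, lfVal_act,
      hY.unbraidU_mul_tmul _ (hh.act (Uq.hasDeg_E_pow i)) hy hN'' hN', Finset.smul_sum]
    refine Finset.sum_congr rfl fun j _ => ?_
    rw [Finset.smul_sum]
    refine Finset.sum_congr rfl fun k _ => ?_
    rw [act_E_pow_comp, Uq.v_eq, map_smul, LinearMap.smul_apply, mul_smul_comm, smul_mul_assoc,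
      ← TensorProduct.smul_tmul', smul_smul, smul_smul, _root_.mul_assoc (lfVal g)]
    simp only [T]
    congr 1
    ring
  have hr : ordMul Y (unbraidLf Y (g ⊗ₜ h)) (unbraidLf Y (x ⊗ₜ y)) =
      ∑ k ∈ Finset.range N, ∑ m ∈ Finset.range N,
        ∑ p ∈ Finset.HasAntidiagonal.antidiagonal m, T p.2 p.1 k := by
    rw [unbraidLf_tmul, unbraidLf_tmul, hY.graded.unbraidU_tmul _ hh hN, hY.graded.unbraidU_tmul _ hy hN', Finset.sum_comm,
      map_sum (ordMul Y), LinearMap.sum_apply]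
    refine Finset.sum_congr rfl fun m _ => ?_
    rw [map_sum]
    refine Finset.sum_congr rfl fun k _ => ?_
    rw [ordMul_tmul, _root_.mul_assoc (lfVal g), Uq.Kz_mul_v_mul_Kz_mul_v hx.hasDeg_lfVal d f m k,
      Finset.mul_sum, TensorProduct.sum_tmul]
    refine Finset.sum_congr rfl fun p hp => ?_
    rw [Finset.HasAntidiagonal.mem_antidiagonal] at hp
    rw [mul_smul_comm, ← TensorProduct.smul_tmul', ← hp]
  rw [hl, hr]
  have hT : ∀ k, ∑ m ∈ Finset.range N, ∑ p ∈ Finset.HasAntidiagonal.antidiagonal m, T p.2 p.1 k =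
      ∑ j ∈ Finset.range N, ∑ i ∈ Finset.range N, T i j k := by
    intro k
    refine Finset.sum_range_sum_antidiagonal (fun j i => T i j k) N N N fun j i hji => ?_
    have h1 : j + i < N := by
      by_contra h1
      exact hji (by simp only [T]; rw [hN _ (by omega), map_zero, LinearMap.zero_apply,
        TensorProduct.tmul_zero, smul_zero])
    omega
  simp only [hT]
  rw [Finset.sum_comm]
  conv_lhs => enter [2, j]; rw [Finset.sum_comm]
  rw [Finset.sum_comm]

theorem IsModuleAlgebra.unbraidLf_mul (hY : Y.IsModuleAlgebra)
    (s t : lf.carrier ⊗[Cq] Y.carrier) :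
    unbraidLf Y (braidedMul lf Y s t) = ordMul Y (unbraidLf Y s) (unbraidLf Y t) := by
  induction s using hY.graded.tensor_induction with
  | h0 => simp
  | hadd s s' hs hs' => simp only [map_add, LinearMap.add_apply, hs, hs']
  | hsmul c s hs => simp only [map_smul, LinearMap.smul_apply, hs]
  | hw g d h hh =>
    induction t using hY.graded.tensor_induction with
    | h0 => simp
    | hadd t t' ht ht' => simp only [map_add, ht, ht']
    | hsmul c t ht => simp only [map_smul, ht]
    | hw x f y hy =>
      induction lf_graded.span x using Submodule.span_induction with
      | mem x hx =>
        obtain ⟨e, hx⟩ := hx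
        exact hY.unbraidLf_mul_tmul g x hx hh hy
      | zero => simp
      | add x x' _ _ h1 h2 => simp only [TensorProduct.add_tmul, map_add, h1, h2]
      | smul c x _ h1 => simp only [← TensorProduct.smul_tmul', map_smul, h1]

/-! ### Injectivity of the unbraiding map -/

/-- The map `a ⊗ y ↦ a K^{|y|} ⊗ y`. -/
noncomputable def twist (Y : BrObj) (c : ℤ) : Uq ⊗[Cq] Y.carrier →ₗ[Cq] Uq ⊗[Cq] Y.carrier :=
  locSum (fun d : ℤ => TensorProduct.map (LinearMap.mulRight Cq (Uq.Kz (c * d))) (Y.proj d))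
    (finite_support_tensor _ fun a y => (Y.proj_finite y).subset fun d hd h0 => hd (by
      simp only [TensorProduct.map_tmul, h0, TensorProduct.tmul_zero]))

theorem Graded.twist_tmul (hY : Y.Graded) (c : ℤ) (a : Uq) {d : ℤ} {b : Y.carrier}
    (hb : Y.IsWt d b) : twist Y c (a ⊗ₜ b) = (a * Uq.Kz (c * d)) ⊗ₜ b := by
  change ∑ᶠ e : ℤ, TensorProduct.map (LinearMap.mulRight Cq (Uq.Kz (c * e))) (Y.proj e) (a ⊗ₜ b) = _
  simp only [TensorProduct.map_tmul, hY.proj_wt d b hb]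
  rw [finsum_eq_single _ d (fun c hc => by rw [if_neg hc, TensorProduct.tmul_zero]), if_pos rfl]
  rfl

theorem Graded.twist_twist (hY : Y.Graded) (t : Uq ⊗[Cq] Y.carrier) :
    twist Y (-1) (twist Y 1 t) = t := by
  refine LinearMap.congr_fun (f := twist Y (-1) ∘ₗ twist Y 1) (g := LinearMap.id)
    (hY.tensor_ext fun a d b hb => ?_) t
  rw [LinearMap.comp_apply, hY.twist_tmul _ _ hb, hY.twist_tmul _ _ hb, _root_.mul_assoc, one_mul,
    neg_one_mul, Uq.Kz_mul_Kz_neg, _root_.mul_one, LinearMap.id_apply]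

theorem exists_lTensor_E_pow_eq_zero (t : Uq ⊗[Cq] Y.carrier) :
    ∃ N : ℕ, ∀ i ≥ N, (Y.act (Uq.E ^ i)).lTensor Uq t = 0 := by
  induction t using TensorProduct.induction_on with
  | zero => exact ⟨0, fun i _ => map_zero _⟩
  | tmul a b =>
    obtain ⟨N, hN⟩ := Y.E_nilpotent b
    exact ⟨N, fun i hi => by rw [LinearMap.lTensor_tmul, hN i hi, TensorProduct.tmul_zero]⟩
  | add s t hs ht =>
    obtain ⟨N, hN⟩ := hs
    obtain ⟨N', hN'⟩ := ht
    exact ⟨max N N', fun i hi => by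
      rw [map_add, hN i (le_of_max_le_left hi), hN' i (le_of_max_le_right hi), add_zero]⟩

/-- Up to `twist`, the unbraiding map is unipotent. -/
theorem Graded.exists_unbraidU_eq_sum (hY : Y.Graded) (t : Uq ⊗[Cq] Y.carrier) :
    ∃ N₀, ∀ N ≥ N₀, unbraidU Y t = ∑ i ∈ Finset.range N,
      TensorProduct.map (LinearMap.mulRight Cq (Uq.Kz i * Uq.v i)) (Y.act (Uq.E ^ i))
        (twist Y 1 t) := by
  induction t using hY.tensor_induction (M := Uq) with
  | h0 => exact ⟨0, fun N _ => by simp⟩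
  | hadd s t hs ht =>
    obtain ⟨N₁, h₁⟩ := hs
    obtain ⟨N₂, h₂⟩ := ht
    refine ⟨max N₁ N₂, fun N hN => ?_⟩
    simp only [map_add]
    rw [h₁ N (le_of_max_le_left hN), h₂ N (le_of_max_le_right hN), Finset.sum_add_distrib]
  | hsmul c t ht =>
    obtain ⟨N₀, h⟩ := ht
    refine ⟨N₀, fun N hN => ?_⟩
    simp only [map_smul]
    rw [h N hN, Finset.smul_sum]
  | hw a d b hb =>
    obtain ⟨N₀, hN₀⟩ := Y.E_nilpotent b
    refine ⟨N₀, fun N hN => ?_⟩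
    rw [hY.unbraidU_tmul a hb (fun i hi => hN₀ i (le_trans hN hi)), hY.twist_tmul _ _ hb]
    refine Finset.sum_congr rfl fun i _ => ?_
    rw [TensorProduct.map_tmul, LinearMap.mulRight_apply, one_mul, add_comm, Uq.Kz_add]
    simp only [_root_.mul_assoc]

theorem Graded.unbraidU_injective (hY : Y.Graded) : Function.Injective (unbraidU Y) := by
  classical
  rw [← LinearMap.ker_eq_bot, LinearMap.ker_eq_bot']
  intro t ht
  obtain ⟨N₀, hN₀⟩ := hY.exists_unbraidU_eq_sum t
  rw [← hY.twist_twist t]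
  generalize twist Y 1 t = w at hN₀
  have hex := exists_lTensor_E_pow_eq_zero w
  suffices hw : w = 0 by rw [hw, map_zero]
  obtain hk | hk := Nat.eq_zero_or_pos (Nat.find hex)
  · have h := Nat.find_spec hex 0 (by omega)
    simpa [Module.End.one_eq_id] using h
  · exfalso
    obtain ⟨k, hk⟩ : ∃ k, Nat.find hex = k + 1 := ⟨_, (Nat.succ_pred_eq_of_pos hk).symm⟩
    have h1 : ∀ i ≥ k + 1, (Y.act (Uq.E ^ i)).lTensor Uq w = 0 := hk ▸ Nat.find_spec hex
    refine Nat.find_min hex (m := k) (by omega) fun i hi => ?_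
    obtain rfl | hi := Nat.eq_or_lt_of_le hi
    · have h2 : ∀ j : ℕ, (Y.act (Uq.E ^ k)).lTensor Uq (TensorProduct.map
          (LinearMap.mulRight Cq (Uq.Kz j * Uq.v j)) (Y.act (Uq.E ^ j)) w) =
          (LinearMap.mulRight Cq (Uq.Kz j * Uq.v j)).rTensor Y.carrier
            ((Y.act (Uq.E ^ (k + j))).lTensor Uq w) := by
        intro j
        rw [← LinearMap.comp_apply, ← LinearMap.comp_apply, LinearMap.rTensor_comp_lTensor,
          LinearMap.lTensor_comp_map, pow_add, map_mul]
        rfl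
      have h3 := congrArg ((Y.act (Uq.E ^ k)).lTensor Uq) (hN₀ (N₀ + 1) (by omega))
      rw [ht, map_zero, map_sum, Finset.sum_range_succ', Finset.sum_eq_zero, zero_add, h2] at h3
      · rw [h3]
        simp [Uq.v_eq]
      · intro j _
        rw [h2, h1 _ (by omega), map_zero]
    · exact h1 i hi

theorem Graded.unbraidLf_injective (hY : Y.Graded) : Function.Injective (unbraidLf Y) :=
  hY.unbraidU_injective.comp
    (Module.Flat.rTensor_preserves_injective_linearMap _ lfVal_injective)

end BrObj

namespace BrObj

variable {Y : BrObj}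

/-! ### The action on `U_q(sl₂) ⊗ Y` which the unbraiding map respects -/

/-- Action of `K` on `U_q(sl₂) ⊗ Y`. -/
noncomputable def outK (Y : BrObj) : Uq ⊗[Cq] Y.carrier →ₗ[Cq] Uq ⊗[Cq] Y.carrier :=
  TensorProduct.map (LinearMap.mulLeft Cq Uq.K ∘ₗ LinearMap.mulRight Cq Uq.Kinv) (Y.act Uq.K)

/-- Action of `K⁻¹` on `U_q(sl₂) ⊗ Y`. -/
noncomputable def outKinv (Y : BrObj) : Uq ⊗[Cq] Y.carrier →ₗ[Cq] Uq ⊗[Cq] Y.carrier :=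
  TensorProduct.map (LinearMap.mulLeft Cq Uq.Kinv ∘ₗ LinearMap.mulRight Cq Uq.K) (Y.act Uq.Kinv)

/-- Action of `E` on `U_q(sl₂) ⊗ Y`. -/
noncomputable def outE (Y : BrObj) : Uq ⊗[Cq] Y.carrier →ₗ[Cq] Uq ⊗[Cq] Y.carrier :=
  TensorProduct.map (LinearMap.mulLeft Cq Uq.E ∘ₗ LinearMap.mulRight Cq Uq.Kinv) (Y.act Uq.K) +
    (LinearMap.mulRight Cq Uq.Kinv).rTensor Y.carrier ∘ₗ (Y.act Uq.E).lTensor Uq -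
    (LinearMap.mulRight Cq (Uq.E * Uq.Kinv)).rTensor Y.carrier

/-- Action of `F` on `U_q(sl₂) ⊗ Y`. -/
noncomputable def outF (Y : BrObj) : Uq ⊗[Cq] Y.carrier →ₗ[Cq] Uq ⊗[Cq] Y.carrier :=
  (LinearMap.mulLeft Cq Uq.F).rTensor Y.carrier +
    TensorProduct.map (LinearMap.mulLeft Cq Uq.Kinv) (Y.act Uq.F) -
    TensorProduct.map (LinearMap.mulLeft Cq Uq.Kinv ∘ₗ LinearMap.mulRight Cq (Uq.K * Uq.F))
      (Y.act Uq.Kinv)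

theorem outK_tmul (a : Uq) (b : Y.carrier) :
    outK Y (a ⊗ₜ b) = (Uq.K * (a * Uq.Kinv)) ⊗ₜ Y.act Uq.K b := rfl

theorem outKinv_tmul (a : Uq) (b : Y.carrier) :
    outKinv Y (a ⊗ₜ b) = (Uq.Kinv * (a * Uq.K)) ⊗ₜ Y.act Uq.Kinv b := rfl

theorem outE_tmul (a : Uq) (b : Y.carrier) : outE Y (a ⊗ₜ b) =
    (Uq.E * (a * Uq.Kinv)) ⊗ₜ Y.act Uq.K b + (a * Uq.Kinv) ⊗ₜ Y.act Uq.E b -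
      (a * (Uq.E * Uq.Kinv)) ⊗ₜ b := rfl

theorem outF_tmul (a : Uq) (b : Y.carrier) : outF Y (a ⊗ₜ b) =
    (Uq.F * a) ⊗ₜ b + (Uq.Kinv * a) ⊗ₜ Y.act Uq.F b -
      (Uq.Kinv * (a * (Uq.K * Uq.F))) ⊗ₜ Y.act Uq.Kinv b := rfl

theorem ord_induction {P : Uq ⊗[Cq] Y.carrier → Uq ⊗[Cq] Y.carrier → Prop}
    (h0 : ∀ t, P 0 t) (h0' : ∀ s, P s 0) (hl : ∀ s s' t, P s t → P s' t → P (s + s') t)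
    (hr : ∀ s t t', P s t → P s t' → P s (t + t'))
    (h : ∀ a b x y, P (a ⊗ₜ x) (b ⊗ₜ y)) (s t) : P s t := by
  induction s using TensorProduct.induction_on with
  | zero => exact h0 t
  | add s s' h1 h2 => exact hl _ _ _ h1 h2
  | tmul a x =>
    induction t using TensorProduct.induction_on with
    | zero => exact h0' _
    | add t t' h1 h2 => exact hr _ _ _ h1 h2
    | tmul b y => exact h a b x y

theorem IsModuleAlgebra.outK_ordMul (hY : Y.IsModuleAlgebra) (s t : Uq ⊗[Cq] Y.carrier) :
    outK Y (ordMul Y s t) = ordMul Y (outK Y s) (outK Y t) := by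
  refine ord_induction (P := fun s t => outK Y (ordMul Y s t) = ordMul Y (outK Y s) (outK Y t))
    (fun t => by simp) (fun s => by simp)
    (fun s s' t h1 h2 => by simp only [map_add, LinearMap.add_apply, h1, h2])
    (fun s t t' h1 h2 => by simp only [map_add, h1, h2]) (fun a b x y => ?_) s t
  have h : Uq.K * (a * Uq.Kinv) * (Uq.K * (b * Uq.Kinv)) =
      Uq.K * (a * (Uq.Kinv * Uq.K * (b * Uq.Kinv))) := by simp only [_root_.mul_assoc]
  rw [ordMul_tmul, outK_tmul, outK_tmul, outK_tmul, ordMul_tmul, hY.act_K_mul, h, Uq.Kinv_mul_K,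
    _root_.one_mul, _root_.mul_assoc a]

theorem IsModuleAlgebra.outKinv_ordMul (hY : Y.IsModuleAlgebra) (s t : Uq ⊗[Cq] Y.carrier) :
    outKinv Y (ordMul Y s t) = ordMul Y (outKinv Y s) (outKinv Y t) := by
  refine ord_induction (P := fun s t => outKinv Y (ordMul Y s t) = ordMul Y (outKinv Y s) (outKinv Y t))
    (fun t => by simp) (fun s => by simp)
    (fun s s' t h1 h2 => by simp only [map_add, LinearMap.add_apply, h1, h2])
    (fun s t t' h1 h2 => by simp only [map_add, h1, h2]) (fun a b x y => ?_) s t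
  have h : Uq.Kinv * (a * Uq.K) * (Uq.Kinv * (b * Uq.K)) =
      Uq.Kinv * (a * (Uq.K * Uq.Kinv * (b * Uq.K))) := by simp only [_root_.mul_assoc]
  rw [ordMul_tmul, outKinv_tmul, outKinv_tmul, outKinv_tmul, ordMul_tmul, hY.act_Kinv_mul, h,
    Uq.K_mul_Kinv, _root_.one_mul, _root_.mul_assoc a]

theorem IsModuleAlgebra.outE_ordMul (hY : Y.IsModuleAlgebra) (s t : Uq ⊗[Cq] Y.carrier) :
    outE Y (ordMul Y s t) = ordMul Y (outE Y s) (outK Y t) + ordMul Y s (outE Y t) := by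
  refine ord_induction (P := fun s t => outE Y (ordMul Y s t) =
    ordMul Y (outE Y s) (outK Y t) + ordMul Y s (outE Y t))
    (fun t => by simp) (fun s => by simp)
    (fun s s' t h1 h2 => by simp only [map_add, LinearMap.add_apply, h1, h2]; abel)
    (fun s t t' h1 h2 => by simp only [map_add, h1, h2]; abel) (fun a b x y => ?_) s t
  have h1 : ∀ c, Uq.Kinv * (Uq.K * c) = c := fun c => by
    rw [← _root_.mul_assoc, Uq.Kinv_mul_K, _root_.one_mul]
  simp only [ordMul_tmul, outE_tmul, outK_tmul, map_add, map_sub, LinearMap.add_apply,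
    LinearMap.sub_apply, hY.act_K_mul, hY.act_E_mul, TensorProduct.tmul_add, _root_.mul_assoc, h1]
  abel

theorem IsModuleAlgebra.outF_ordMul (hY : Y.IsModuleAlgebra) (s t : Uq ⊗[Cq] Y.carrier) :
    outF Y (ordMul Y s t) = ordMul Y (outF Y s) t + ordMul Y (outKinv Y s) (outF Y t) := by
  refine ord_induction (P := fun s t => outF Y (ordMul Y s t) =
    ordMul Y (outF Y s) t + ordMul Y (outKinv Y s) (outF Y t))
    (fun t => by simp) (fun s => by simp)
    (fun s s' t h1 h2 => by simp only [map_add, LinearMap.add_apply, h1, h2]; abel)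
    (fun s t t' h1 h2 => by simp only [map_add, h1, h2]; abel) (fun a b x y => ?_) s t
  have h1 : ∀ c, Uq.K * (Uq.Kinv * c) = c := fun c => by
    rw [← _root_.mul_assoc, Uq.K_mul_Kinv, _root_.one_mul]
  simp only [ordMul_tmul, outF_tmul, outKinv_tmul, map_add, map_sub, LinearMap.add_apply,
    LinearMap.sub_apply, hY.act_Kinv_mul, hY.act_F_mul, TensorProduct.tmul_add, _root_.mul_assoc,
    h1]
  abel

/-! ### Equivariance -/

theorem _root_.Uq.hasDeg_Kz_mul_v (m : ℤ) (i : ℕ) : Uq.HasDeg (-i) (Uq.Kz m * Uq.v i) := by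
  have h : Uq.HasDeg 0 (Uq.Kz m) := by
    unfold Uq.HasDeg
    rw [← Uq.Kz_one, ← Uq.Kz_add, ← Uq.Kz_add, add_comm]
    simp
  simpa using h.mul (Uq.hasDeg_v i)

theorem _root_.Uq.Kz_mul_v_mul_E_mul_Kinv_sub (d : ℤ) (i : ℕ) :
    Uq.Kz ((i + 1 : ℕ) + d) * Uq.v (i + 1) * (Uq.E * Uq.Kinv) -
        qq ^ (2 * d) • (Uq.E * Uq.Kinv * (Uq.Kz ((i + 1 : ℕ) + d) * Uq.v (i + 1))) =
      Uq.Kz (i + d) * Uq.v i * Uq.Kinv - Uq.K * (Uq.Kz (i + d) * Uq.v i) := by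
  have hK : Uq.Kz ((i + 1 : ℕ) + d) * Uq.Kinv = Uq.Kz (i + d) := by
    rw [← Uq.Kz_neg_one, ← Uq.Kz_add]
    congr 1
    push_cast
    ring
  have hK' : Uq.Kinv * Uq.Kz ((i + 1 : ℕ) + d) = Uq.Kz (i + d) := by
    rw [← Uq.Kz_neg_one, ← Uq.Kz_add]
    congr 1
    push_cast
    ring
  have hK'' : Uq.Kz (i + d) * Uq.K = Uq.K * Uq.Kz (i + d) := by
    rw [← Uq.Kz_one, ← Uq.Kz_add, ← Uq.Kz_add, add_comm]
  have h1 : Uq.Kz ((i + 1 : ℕ) + d) * Uq.v (i + 1) * (Uq.E * Uq.Kinv) =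
      qq ^ (2 * (-i : ℤ)) • (Uq.Kz (i + d) * (Uq.v (i + 1) * Uq.E)) := by
    have h := ((Uq.hasDeg_v (i + 1)).mul Uq.hasDeg_E).mul_Kinv
    rw [← _root_.mul_assoc, _root_.mul_assoc (Uq.Kz _), _root_.mul_assoc, h, mul_smul_comm,
      ← _root_.mul_assoc (Uq.Kz _), hK]
    congr 3
    push_cast
    ring
  have h2 : qq ^ (2 * d) • (Uq.E * Uq.Kinv * (Uq.Kz ((i + 1 : ℕ) + d) * Uq.v (i + 1))) =
      qq ^ (2 * (-i : ℤ)) • (Uq.Kz (i + d) * (Uq.E * Uq.v (i + 1))) := by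
    rw [_root_.mul_assoc Uq.E, ← _root_.mul_assoc Uq.Kinv, hK', ← _root_.mul_assoc Uq.E,
      Uq.hasDeg_E.mul_Kz, smul_mul_assoc, smul_smul, ← zpow_add₀ Uq.qq_ne_zero,
      _root_.mul_assoc (Uq.Kz _)]
    congr 2
    ring
  rw [h1, h2, ← smul_sub, ← mul_sub, ← neg_sub, Uq.E_mul_v_sub, (Uq.hasDeg_v i).mul_K, neg_sub,
    mul_sub, mul_smul_comm, smul_sub, smul_smul, ← zpow_add₀ Uq.qq_ne_zero, add_neg_cancel,
    zpow_zero, one_smul, ← _root_.mul_assoc (Uq.Kz _) Uq.K, hK'', ← mul_smul_comm,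
    ← (Uq.hasDeg_v i).mul_Kinv]
  simp only [_root_.mul_assoc]

theorem _root_.Uq.Kz_mul_v_zero_mul_E_mul_Kinv_sub (d : ℤ) :
    Uq.Kz ((0 : ℕ) + d) * Uq.v 0 * (Uq.E * Uq.Kinv) -
        qq ^ (2 * d) • (Uq.E * Uq.Kinv * (Uq.Kz ((0 : ℕ) + d) * Uq.v 0)) = 0 := by
  have h0 : Uq.v 0 = 1 := by simp [Uq.v_eq]
  rw [h0, _root_.mul_one, Nat.cast_zero, zero_add, _root_.mul_assoc Uq.E, ← Uq.Kz_neg_one,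
    ← Uq.Kz_add, Uq.hasDeg_E.mul_Kz, Uq.hasDeg_E.mul_Kz, mul_smul_comm, smul_smul,
    ← _root_.mul_assoc (Uq.Kz _), ← Uq.Kz_add, ← zpow_add₀ Uq.qq_ne_zero, add_comm d, sub_eq_zero]
  congr 2
  ring

theorem _root_.Uq.K_mul_F_mul_Kz_mul_v_sub (d : ℤ) (i : ℕ) :
    Uq.K * Uq.F * (Uq.Kz (i + d) * Uq.v i) -
        qq ^ (-(2 * (i + d))) • (Uq.Kz (i + d) * Uq.v i * (Uq.K * Uq.F)) =
      (Uq.cc i * (qq ^ (2 * (i + d)) - qq ^ (-(2 * d)))) •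
        (Uq.Kz ((i + 1 : ℕ) + d) * Uq.F ^ (i + 1)) := by
  have h1 : Uq.K * Uq.F * (Uq.Kz (i + d) * Uq.v i) =
      (Uq.cc i * qq ^ (2 * (i + d))) • (Uq.Kz ((i + 1 : ℕ) + d) * Uq.F ^ (i + 1)) := by
    have hK : Uq.Kz ((i + 1 : ℕ) + d) = Uq.K * Uq.Kz (i + d) := by
      rw [← Uq.Kz_one, ← Uq.Kz_add]
      congr 1
      push_cast
      ring
    rw [hK, Uq.v_eq, mul_smul_comm, mul_smul_comm, _root_.mul_assoc Uq.K,
      ← _root_.mul_assoc Uq.F, Uq.hasDeg_F.mul_Kz, smul_mul_assoc, mul_smul_comm, smul_smul,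
      pow_succ']
    simp only [_root_.mul_assoc]
    congr 3
    ring
  have h2 : qq ^ (-(2 * (i + d))) • (Uq.Kz (i + d) * Uq.v i * (Uq.K * Uq.F)) =
      (Uq.cc i * qq ^ (-(2 * d))) • (Uq.Kz ((i + 1 : ℕ) + d) * Uq.F ^ (i + 1)) := by
    have hK : Uq.Kz ((i + 1 : ℕ) + d) = Uq.Kz (i + d) * Uq.K := by
      rw [← Uq.Kz_one, ← Uq.Kz_add]
      congr 1
      push_cast
      ring
    rw [hK, Uq.v_eq, mul_smul_comm, smul_mul_assoc, _root_.mul_assoc (Uq.Kz _),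
      ← _root_.mul_assoc (Uq.F ^ i), (Uq.hasDeg_F_pow i).mul_K, smul_mul_assoc, mul_smul_comm,
      smul_smul, smul_smul, pow_succ, mul_comm (qq ^ _), _root_.mul_assoc (Uq.cc i),
      ← zpow_add₀ Uq.qq_ne_zero]
    simp only [_root_.mul_assoc]
    congr 3
    ring
  rw [h1, h2, ← sub_smul, mul_sub]

theorem Graded.unbraidLf_act_K (hY : Y.Graded) (t : lf.carrier ⊗[Cq] Y.carrier) :
    unbraidLf Y (tensorAct lf Y Uq.K t) = outK Y (unbraidLf Y t) := by
  induction t using hY.tensor_induction with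
  | h0 => simp
  | hadd s t hs ht => simp only [map_add, hs, ht]
  | hsmul c t ht => simp only [map_smul, ht]
  | hw a d b hb =>
    obtain ⟨N, hN⟩ := Y.E_nilpotent b
    rw [tensorAct_K, hb.act_K, TensorProduct.tmul_smul, map_smul, unbraidLf_tmul, unbraidLf_tmul,
      hY.unbraidU_tmul _ hb hN, hY.unbraidU_tmul _ hb hN, lfVal_act, Uq.ad_K, map_sum,
      Finset.smul_sum]
    refine Finset.sum_congr rfl fun i _ => ?_
    rw [outK_tmul, (hb.act (Uq.hasDeg_E_pow i)).act_K, TensorProduct.tmul_smul,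
      _root_.mul_assoc (lfVal a), (Uq.hasDeg_Kz_mul_v _ i).mul_Kinv, mul_smul_comm, mul_smul_comm,
      ← TensorProduct.smul_tmul', smul_smul, ← zpow_add₀ Uq.qq_ne_zero]
    simp only [_root_.mul_assoc]
    congr 2
    ring

theorem Graded.unbraidLf_act_Kinv (hY : Y.Graded) (t : lf.carrier ⊗[Cq] Y.carrier) :
    unbraidLf Y (tensorAct lf Y Uq.Kinv t) = outKinv Y (unbraidLf Y t) := by
  induction t using hY.tensor_induction with
  | h0 => simp
  | hadd s t hs ht => simp only [map_add, hs, ht]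
  | hsmul c t ht => simp only [map_smul, ht]
  | hw a d b hb =>
    obtain ⟨N, hN⟩ := Y.E_nilpotent b
    rw [tensorAct_Kinv, hb.act_Kinv, TensorProduct.tmul_smul, map_smul, unbraidLf_tmul,
      unbraidLf_tmul, hY.unbraidU_tmul _ hb hN, hY.unbraidU_tmul _ hb hN, lfVal_act, Uq.ad_Kinv,
      map_sum, Finset.smul_sum]
    refine Finset.sum_congr rfl fun i _ => ?_
    rw [outKinv_tmul, (hb.act (Uq.hasDeg_E_pow i)).act_Kinv, TensorProduct.tmul_smul,
      _root_.mul_assoc (lfVal a), (Uq.hasDeg_Kz_mul_v _ i).mul_K, mul_smul_comm, mul_smul_comm,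
      ← TensorProduct.smul_tmul', smul_smul, ← zpow_add₀ Uq.qq_ne_zero]
    simp only [_root_.mul_assoc]
    congr 2
    ring

theorem Graded.unbraidLf_act_E (hY : Y.Graded) (t : lf.carrier ⊗[Cq] Y.carrier) :
    unbraidLf Y (tensorAct lf Y Uq.E t) = outE Y (unbraidLf Y t) := by
  induction t using hY.tensor_induction with
  | h0 => simp
  | hadd s t hs ht => simp only [map_add, hs, ht]
  | hsmul c t ht => simp only [map_smul, ht]
  | hw a d b hb =>
    obtain ⟨N, hN⟩ := Y.E_nilpotent b
    have hN1 : ∀ i ≥ N + 1, Y.act (Uq.E ^ i) b = 0 := fun i hi => hN i (by omega)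
    have hEb : ∀ i, Y.act (Uq.E ^ i) (Y.act Uq.E b) = Y.act (Uq.E ^ (i + 1)) b := by
      intro i
      rw [← pow_one Uq.E, ← pow_mul, act_E_pow_comp, pow_one, _root_.one_mul]
    have hN2 : ∀ i ≥ N, Y.act (Uq.E ^ i) (Y.act Uq.E b) = 0 := fun i hi => by
      rw [hEb, hN _ (by omega)]
    let W : ℕ → Uq := fun i => Uq.Kz (i + d) * Uq.v i
    let x := lfVal a
    have hl : unbraidLf Y (tensorAct lf Y Uq.E (a ⊗ₜ b)) =
        ∑ i ∈ Finset.range (N + 1), (qq ^ (2 * d) • (Uq.E * (x * (Uq.Kinv * W i)))) ⊗ₜ[Cq]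
            Y.act (Uq.E ^ i) b -
          ∑ i ∈ Finset.range (N + 1), (x * (qq ^ (2 * d) • (Uq.E * Uq.Kinv * W i))) ⊗ₜ[Cq]
            Y.act (Uq.E ^ i) b +
          ∑ i ∈ Finset.range N, (x * (Uq.K * W i)) ⊗ₜ[Cq] Y.act (Uq.E ^ (i + 1)) b := by
      rw [tensorAct_E, map_add, hb.act_K, TensorProduct.tmul_smul, map_smul, unbraidLf_tmul,
        unbraidLf_tmul, hY.unbraidU_tmul _ hb hN1, hY.unbraidU_tmul _ (hb.act Uq.hasDeg_E) hN2,
        lfVal_act, Uq.ad_E, Finset.smul_sum, ← Finset.sum_sub_distrib]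
      congr 1
      · refine Finset.sum_congr rfl fun i _ => ?_
        rw [← TensorProduct.sub_tmul, TensorProduct.smul_tmul', sub_mul, smul_sub, mul_smul_comm]
        simp only [W, x, _root_.mul_assoc]
      · refine Finset.sum_congr rfl fun i _ => ?_
        rw [hEb, ← _root_.mul_assoc Uq.K, ← Uq.Kz_one, ← Uq.Kz_add]
        congr 4
        ring
    have hr : outE Y (unbraidLf Y (a ⊗ₜ b)) =
        ∑ i ∈ Finset.range (N + 1), (qq ^ (2 * d) • (Uq.E * (x * (Uq.Kinv * W i)))) ⊗ₜ[Cq]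
            Y.act (Uq.E ^ i) b +
          ∑ i ∈ Finset.range N, (x * (W i * Uq.Kinv)) ⊗ₜ[Cq] Y.act (Uq.E ^ (i + 1)) b -
          ∑ i ∈ Finset.range (N + 1), (x * (W i * (Uq.E * Uq.Kinv))) ⊗ₜ[Cq]
            Y.act (Uq.E ^ i) b := by
      have h0 : ∑ i ∈ Finset.range N, (x * (W i * Uq.Kinv)) ⊗ₜ[Cq] Y.act (Uq.E ^ (i + 1)) b =
          ∑ i ∈ Finset.range (N + 1), (x * (W i * Uq.Kinv)) ⊗ₜ[Cq]
            Y.act (Uq.E ^ (i + 1)) b := by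
        rw [Finset.sum_range_succ, hN (N + 1) (by omega), TensorProduct.tmul_zero, add_zero]
      rw [h0, unbraidLf_tmul, hY.unbraidU_tmul _ hb hN1, map_sum, ← Finset.sum_add_distrib,
        ← Finset.sum_sub_distrib]
      refine Finset.sum_congr rfl fun i _ => ?_
      rw [outE_tmul, (hb.act (Uq.hasDeg_E_pow i)).act_K, TensorProduct.tmul_smul,
        TensorProduct.smul_tmul', ← Module.End.mul_apply, ← map_mul, ← pow_succ',
        _root_.mul_assoc (lfVal a), (Uq.hasDeg_Kz_mul_v _ i).mul_Kinv, ← mul_smul_comm (qq ^ _),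
        ← mul_smul_comm (qq ^ _), smul_smul, ← zpow_add₀ Uq.qq_ne_zero,
        show 2 * ((i : ℤ) + d) + 2 * (-i) = 2 * d by ring, mul_smul_comm (qq ^ _),
        mul_smul_comm (qq ^ _), ← (Uq.hasDeg_Kz_mul_v _ i).mul_Kinv, _root_.mul_assoc (lfVal a)]
    have hs : ∑ i ∈ Finset.range (N + 1), (x * (W i * (Uq.E * Uq.Kinv) -
          qq ^ (2 * d) • (Uq.E * Uq.Kinv * W i))) ⊗ₜ[Cq] Y.act (Uq.E ^ i) b =
        ∑ i ∈ Finset.range N, (x * (W i * Uq.Kinv - Uq.K * W i)) ⊗ₜ[Cq]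
          Y.act (Uq.E ^ (i + 1)) b := by
      rw [Finset.sum_range_succ']
      simp only [W, Uq.Kz_mul_v_mul_E_mul_Kinv_sub, Uq.Kz_mul_v_zero_mul_E_mul_Kinv_sub, mul_zero,
        TensorProduct.zero_tmul, add_zero]
    simp only [mul_sub, TensorProduct.sub_tmul, Finset.sum_sub_distrib] at hs
    rw [hl, hr, ← sub_eq_zero]
    rw [← sub_eq_zero] at hs
    rw [← hs]
    abel

theorem Graded.unbraidLf_act_F (hY : Y.Graded) (t : lf.carrier ⊗[Cq] Y.carrier) :
    unbraidLf Y (tensorAct lf Y Uq.F t) = outF Y (unbraidLf Y t) := by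
  induction t using hY.tensor_induction with
  | h0 => simp
  | hadd s t hs ht => simp only [map_add, hs, ht]
  | hsmul c t ht => simp only [map_smul, ht]
  | hw a d b hb =>
    obtain ⟨N₁, hN₁⟩ := Y.E_nilpotent b
    obtain ⟨N₂, hN₂⟩ := Y.E_nilpotent (Y.act Uq.F b)
    have hN : ∀ i ≥ max N₁ N₂, Y.act (Uq.E ^ i) b = 0 := fun i hi => hN₁ i (le_of_max_le_left hi)
    have hN' : ∀ i ≥ max N₁ N₂ + 1, Y.act (Uq.E ^ i) (Y.act Uq.F b) = 0 :=
      fun i hi => hN₂ i (le_of_max_le_right (Nat.le_of_succ_le hi))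
    generalize max N₁ N₂ = N at hN hN'
    have hN1 : ∀ i ≥ N + 1, Y.act (Uq.E ^ i) b = 0 := fun i hi => hN i (by omega)
    let W : ℕ → Uq := fun i => Uq.Kz (i + d) * Uq.v i
    let x := Uq.Kinv * lfVal a
    have hl : unbraidLf Y (tensorAct lf Y Uq.F (a ⊗ₜ b)) =
        ∑ i ∈ Finset.range (N + 1), (Uq.F * lfVal a * W i) ⊗ₜ[Cq] Y.act (Uq.E ^ i) b -
          ∑ i ∈ Finset.range (N + 1), (x * (Uq.K * Uq.F * W i)) ⊗ₜ[Cq] Y.act (Uq.E ^ i) b +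
          ∑ i ∈ Finset.range (N + 1), (x * W i) ⊗ₜ[Cq] Y.act (Uq.E ^ i) (Y.act Uq.F b) := by
      rw [tensorAct_F, map_add, unbraidLf_tmul,
        unbraidLf_tmul, hY.unbraidU_tmul _ hb hN1, hY.unbraidU_tmul _ (hb.act Uq.hasDeg_F) hN',
        lfVal_act, lfVal_act, Uq.ad_F, Uq.ad_Kinv, ← Finset.sum_sub_distrib]
      congr 1
      · refine Finset.sum_congr rfl fun i _ => ?_
        rw [← TensorProduct.sub_tmul, sub_mul]
        simp only [W, x, _root_.mul_assoc]
      · refine Finset.sum_congr rfl fun i _ => ?_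
        rw [_root_.mul_assoc _ Uq.K, ← _root_.mul_assoc Uq.K, ← Uq.Kz_one, ← Uq.Kz_add]
        congr 4
        ring
    have hr : outF Y (unbraidLf Y (a ⊗ₜ b)) =
        ∑ i ∈ Finset.range (N + 1), (Uq.F * lfVal a * W i) ⊗ₜ[Cq] Y.act (Uq.E ^ i) b +
          ∑ i ∈ Finset.range (N + 1), (x * W i) ⊗ₜ[Cq] Y.act Uq.F (Y.act (Uq.E ^ i) b) -
          ∑ i ∈ Finset.range (N + 1), (x * (qq ^ (-(2 * (i + d))) • (W i * (Uq.K * Uq.F)))) ⊗ₜ[Cq]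
            Y.act (Uq.E ^ i) b := by
      rw [unbraidLf_tmul, hY.unbraidU_tmul _ hb hN1, map_sum, ← Finset.sum_add_distrib,
        ← Finset.sum_sub_distrib]
      refine Finset.sum_congr rfl fun i _ => ?_
      rw [outF_tmul, (hb.act (Uq.hasDeg_E_pow i)).act_Kinv, TensorProduct.tmul_smul,
        TensorProduct.smul_tmul', mul_smul_comm (qq ^ _)]
      simp only [W, x, _root_.mul_assoc]
    have hs : ∑ i ∈ Finset.range (N + 1), (x * W i) ⊗ₜ[Cq]
          (Y.act (Uq.E ^ i) (Y.act Uq.F b) - Y.act Uq.F (Y.act (Uq.E ^ i) b)) =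
        ∑ i ∈ Finset.range (N + 1), (x * (Uq.K * Uq.F * W i -
          qq ^ (-(2 * (i + d))) • (W i * (Uq.K * Uq.F)))) ⊗ₜ[Cq] Y.act (Uq.E ^ i) b := by
      rw [Finset.sum_range_succ', Finset.sum_range_succ _ N, hN N le_rfl, TensorProduct.tmul_zero]
      simp only [pow_zero, map_one, Module.End.one_apply, sub_self, TensorProduct.tmul_zero]
      congr 1
      refine Finset.sum_congr rfl fun i _ => ?_
      have h1 : Uq.cc (i + 1) • (Y.act (Uq.E ^ (i + 1)) (Y.act Uq.F b) -
          Y.act Uq.F (Y.act (Uq.E ^ (i + 1)) b)) =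
          (Uq.cc i * (qq ^ (2 * (i + d)) - qq ^ (-(2 * d)))) • Y.act (Uq.E ^ i) b := by
        have h := congrArg (fun u => Y.act u b) (Uq.cc_smul_E_pow_mul_F_sub i)
        simp only [map_smul, map_sub, map_mul, LinearMap.smul_apply, LinearMap.sub_apply,
          Module.End.mul_apply] at h
        rw [h, (hb.act (Uq.hasDeg_E_pow i)).act_K, hb.act_Kinv, map_smul, ← sub_smul, smul_smul]
      simp only [W]
      rw [Uq.K_mul_F_mul_Kz_mul_v_sub, Uq.v_eq, mul_smul_comm, mul_smul_comm,
        TensorProduct.smul_tmul, h1, mul_smul_comm, TensorProduct.smul_tmul]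
    simp only [mul_sub, TensorProduct.sub_tmul, TensorProduct.tmul_sub,
      Finset.sum_sub_distrib] at hs
    rw [hl, hr, ← sub_eq_zero]
    rw [← sub_eq_zero] at hs
    rw [← hs]
    abel

/-! ### Tensor products of module algebras -/

theorem IsModuleAlgebra.unbraidLf_one (hY : Y.IsModuleAlgebra) :
    unbraidLf Y (lf.one ⊗ₜ Y.one) = 1 ⊗ₜ Y.one := by
  have h : ∀ i ≥ 1, Y.act (Uq.E ^ i) Y.one = 0 := by
    intro i hi
    obtain ⟨j, rfl⟩ := Nat.exists_eq_add_of_le' hi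
    rw [pow_succ, map_mul, Module.End.mul_apply, hY.act_E_one, map_zero]
  rw [unbraidLf_tmul, hY.graded.unbraidU_tmul _ hY.isWt_one h, lfVal_one]
  simp [Uq.v_eq]

theorem IsModuleAlgebra.ordMul_assoc (hY : Y.IsModuleAlgebra) (r s t : Uq ⊗[Cq] Y.carrier) :
    ordMul Y (ordMul Y r s) t = ordMul Y r (ordMul Y s t) := by
  refine ord_induction (P := fun r s => ordMul Y (ordMul Y r s) t = ordMul Y r (ordMul Y s t))
    (fun t => by simp) (fun s => by simp)
    (fun s s' t h1 h2 => by simp only [map_add, LinearMap.add_apply, h1, h2])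
    (fun s t t' h1 h2 => by simp only [map_add, LinearMap.add_apply, h1, h2])
    (fun a b x y => ?_) r s
  induction t using TensorProduct.induction_on with
  | zero => simp
  | add t t' h1 h2 => simp only [map_add, h1, h2]
  | tmul c z => simp only [ordMul_tmul, hY.mul_assoc, _root_.mul_assoc]

theorem IsModuleAlgebra.one_ordMul (hY : Y.IsModuleAlgebra) (t : Uq ⊗[Cq] Y.carrier) :
    ordMul Y (1 ⊗ₜ Y.one) t = t := by
  induction t using TensorProduct.induction_on with
  | zero => simp
  | add t t' h1 h2 => simp only [map_add, h1, h2]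
  | tmul c z => simp only [ordMul_tmul, hY.one_mul, _root_.one_mul]

theorem IsModuleAlgebra.ordMul_one (hY : Y.IsModuleAlgebra) (t : Uq ⊗[Cq] Y.carrier) :
    ordMul Y t (1 ⊗ₜ Y.one) = t := by
  induction t using TensorProduct.induction_on with
  | zero => simp
  | add t t' h1 h2 => simp only [map_add, LinearMap.add_apply, h1, h2]
  | tmul c z => simp only [ordMul_tmul, hY.mul_one, _root_.mul_one]

/-- The braided tensor product of the locally finite part with a module algebra is again a module
algebra: all identities hold after the injective map `unbraidLf`. -/
theorem IsModuleAlgebra.lf_tensor (hY : Y.IsModuleAlgebra) : (tensor lf Y).IsModuleAlgebra where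
  graded := lf_graded.tensor hY.graded
  mul_assoc := fun (x y z : lf.carrier ⊗[Cq] Y.carrier) => hY.graded.unbraidLf_injective (by
    change unbraidLf Y (braidedMul lf Y (braidedMul lf Y x y) z) =
      unbraidLf Y (braidedMul lf Y x (braidedMul lf Y y z))
    simp only [hY.unbraidLf_mul, hY.ordMul_assoc])
  one_mul := fun (x : lf.carrier ⊗[Cq] Y.carrier) => hY.graded.unbraidLf_injective (by
    change unbraidLf Y (braidedMul lf Y (lf.one ⊗ₜ Y.one) x) = _
    rw [hY.unbraidLf_mul, hY.unbraidLf_one, hY.one_ordMul])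
  mul_one := fun (x : lf.carrier ⊗[Cq] Y.carrier) => hY.graded.unbraidLf_injective (by
    change unbraidLf Y (braidedMul lf Y x (lf.one ⊗ₜ Y.one)) = _
    rw [hY.unbraidLf_mul, hY.unbraidLf_one, hY.ordMul_one])
  act_K_mul := fun (x y : lf.carrier ⊗[Cq] Y.carrier) => hY.graded.unbraidLf_injective (by
    change unbraidLf Y (tensorAct lf Y Uq.K (braidedMul lf Y x y)) =
      unbraidLf Y (braidedMul lf Y (tensorAct lf Y Uq.K x) (tensorAct lf Y Uq.K y))
    simp only [hY.unbraidLf_mul, hY.graded.unbraidLf_act_K, hY.outK_ordMul])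
  act_Kinv_mul := fun (x y : lf.carrier ⊗[Cq] Y.carrier) => hY.graded.unbraidLf_injective (by
    change unbraidLf Y (tensorAct lf Y Uq.Kinv (braidedMul lf Y x y)) =
      unbraidLf Y (braidedMul lf Y (tensorAct lf Y Uq.Kinv x) (tensorAct lf Y Uq.Kinv y))
    simp only [hY.unbraidLf_mul, hY.graded.unbraidLf_act_Kinv, hY.outKinv_ordMul])
  act_E_mul := fun (x y : lf.carrier ⊗[Cq] Y.carrier) => hY.graded.unbraidLf_injective (by
    change unbraidLf Y (tensorAct lf Y Uq.E (braidedMul lf Y x y)) =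
      unbraidLf Y (braidedMul lf Y (tensorAct lf Y Uq.E x) (tensorAct lf Y Uq.K y) +
        braidedMul lf Y x (tensorAct lf Y Uq.E y))
    simp only [map_add, hY.unbraidLf_mul, hY.graded.unbraidLf_act_K, hY.graded.unbraidLf_act_E,
      hY.outE_ordMul])
  act_F_mul := fun (x y : lf.carrier ⊗[Cq] Y.carrier) => hY.graded.unbraidLf_injective (by
    change unbraidLf Y (tensorAct lf Y Uq.F (braidedMul lf Y x y)) =
      unbraidLf Y (braidedMul lf Y (tensorAct lf Y Uq.F x) y +
        braidedMul lf Y (tensorAct lf Y Uq.Kinv x) (tensorAct lf Y Uq.F y))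
    simp only [map_add, hY.unbraidLf_mul, hY.graded.unbraidLf_act_Kinv, hY.graded.unbraidLf_act_F,
      hY.outF_ordMul])
  act_K_one := by
    change tensorAct lf Y Uq.K (lf.one ⊗ₜ Y.one) = lf.one ⊗ₜ Y.one
    rw [tensorAct_K, lf_isModuleAlgebra.act_K_one, hY.act_K_one]
  act_E_one := by
    change tensorAct lf Y Uq.E (lf.one ⊗ₜ Y.one) = 0
    rw [tensorAct_E, lf_isModuleAlgebra.act_E_one, hY.act_E_one, TensorProduct.zero_tmul,
      TensorProduct.tmul_zero, add_zero]

end BrObj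

/-! ### Braided tensor powers -/

theorem brPow_isModuleAlgebra : ∀ m, (brPow m).IsModuleAlgebra
  | 0 => BrObj.lf_isModuleAlgebra
  | m + 1 => (brPow_isModuleAlgebra m).lf_tensor

theorem phi_eq_unbraidLf (m : ℕ) : phi m = BrObj.unbraidLf (brPow m) :=
  BrObj.unbraid_eq_unbraidLf

theorem phi_injective (m : ℕ) : Function.Injective (phi m) := by
  rw [phi_eq_unbraidLf]
  exact (brPow_isModuleAlgebra m).graded.unbraidLf_injective

theorem phi_one (m : ℕ) : phi m (brPow (m + 1)).one = 1 ⊗ₜ[Cq] (brPow m).one := by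
  rw [phi_eq_unbraidLf]
  exact (brPow_isModuleAlgebra m).unbraidLf_one

theorem phi_mul (m : ℕ) (x y : (brPow (m + 1)).carrier) :
    phi m ((brPow (m + 1)).mul x y) = (brPow m).ordMul (phi m x) (phi m y) := by
  rw [phi_eq_unbraidLf]
  exact (brPow_isModuleAlgebra m).unbraidLf_mul x y

theorem phi_tmul (m : ℕ) (a : Uq.lf) (d : ℤ) (b : (brPow m).carrier)
    (hb : (brPow m).proj d b = b) :
    {i : ℕ | (brPow m).act (Uq.u i) b ≠ 0}.Finite ∧
      phi m (a ⊗ₜ[Cq] b) =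
        ∑ᶠ i : ℕ, ((a : Uq) * Uq.Kz (i + d) * Uq.v i) ⊗ₜ[Cq] (brPow m).act (Uq.u i) b := by
  have hY := (brPow_isModuleAlgebra m).graded
  obtain ⟨N, hN⟩ := (brPow m).E_nilpotent b
  refine ⟨(Set.finite_Iio N).subset fun i hi => ?_, ?_⟩
  · by_contra h
    exact hi (hN i (not_lt.1 h))
  · rw [finsum_eq_sum_of_support_subset (s := Finset.range N)]
    · simp only [_root_.mul_assoc]
      exact hY.unbraidU_tmul (a : Uq) (hY.isWt_of_proj_eq hb) hN
    · intro i hi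
      rw [Finset.coe_range, Set.mem_Iio]
      by_contra h
      exact hi (by
        have : (brPow m).act (Uq.u i) b = 0 := hN i (not_lt.1 h)
        simp only [this, TensorProduct.tmul_zero])

theorem gamma_injective : ∀ m, Function.Injective (gamma m)
  | 0 => Subtype.val_injective
  | m + 1 => (Module.Flat.lTensor_preserves_injective_linearMap _ (gamma_injective m)).comp
      (phi_injective m)

theorem gamma_one : ∀ m, gamma m (brPow m).one = 1
  | 0 => rfl
  | m + 1 => by
    change (gamma m).lTensor Uq (phi m (brPow (m + 1)).one) = 1
    rw [phi_one, LinearMap.lTensor_tmul, gamma_one m]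
    rfl

theorem gamma_mul : ∀ m x y, gamma m ((brPow m).mul x y) = gamma m x * gamma m y
  | 0, _, _ => rfl
  | m + 1, x, y => by
    have h : ∀ s t : Uq ⊗[Cq] (brPow m).carrier, (gamma m).lTensor Uq ((brPow m).ordMul s t) =
        (gamma m).lTensor Uq s * (gamma m).lTensor Uq t := by
      refine BrObj.ord_induction (fun t => ?_) (fun s => ?_) (fun s s' t h1 h2 => ?_)
        (fun s t t' h1 h2 => ?_) (fun a b x y => ?_)
      · rw [map_zero, map_zero, LinearMap.zero_apply, map_zero, zero_mul]
      · rw [map_zero, map_zero]; exact (mul_zero _).symm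
      · rw [map_add, LinearMap.add_apply, map_add, h1, h2, map_add, add_mul]
      · rw [map_add, map_add, h1, h2, map_add, mul_add]
      · rw [BrObj.ordMul_tmul, LinearMap.lTensor_tmul, LinearMap.lTensor_tmul,
          LinearMap.lTensor_tmul, gamma_mul m, Algebra.TensorProduct.tmul_mul_tmul]
    change (gamma m).lTensor Uq (phi m ((brPow (m + 1)).mul x y)) = _
    rw [phi_mul, h]
    rfl

theorem mainTheorem9 :
    -- the braided tensor powers are associative unital algebras
    (∀ (m : ℕ) (x y z : (brPow m).carrier),
      (brPow m).mul ((brPow m).mul x y) z = (brPow m).mul x ((brPow m).mul y z) ∧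
      (brPow m).mul (brPow m).one x = x ∧
      (brPow m).mul x (brPow m).one = x) ∧
    -- the one-step unbraiding map is given by the formula, and is an injective algebra morphism
    (∀ m : ℕ,
      (∀ (a : Uq.lf) (d : ℤ) (b : (brPow m).carrier), (brPow m).proj d b = b →
        {i : ℕ | (brPow m).act (Uq.u i) b ≠ 0}.Finite ∧
        phi m (a ⊗ₜ[Cq] b) =
          ∑ᶠ i : ℕ, ((a : Uq) * Uq.Kz (i + d) * Uq.v i) ⊗ₜ[Cq] (brPow m).act (Uq.u i) b) ∧
      Function.Injective (phi m) ∧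
      phi m (brPow (m + 1)).one = 1 ⊗ₜ[Cq] (brPow m).one ∧
      ∀ x y : (brPow (m + 1)).carrier,
        phi m ((brPow (m + 1)).mul x y) = (brPow m).ordMul (phi m x) (phi m y)) ∧
    -- the unbraiding map is an injective algebra morphism
    (∀ m : ℕ,
      Function.Injective (gamma m) ∧
      gamma m (brPow m).one = 1 ∧
      ∀ x y : (brPow m).carrier, gamma m ((brPow m).mul x y) = gamma m x * gamma m y) := by

  refine ⟨fun m x y z => ?_, fun m => ⟨phi_tmul m, phi_injective m, phi_one m, phi_mul m⟩,
    fun m => ⟨gamma_injective m, gamma_one m, gamma_mul m⟩⟩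
  have h := brPow_isModuleAlgebra m
  exact ⟨h.mul_assoc x y z, h.one_mul x, h.mul_one x⟩
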